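/- **Theorem (Cauchy inequality).** *Setting.* Let $k\ge 1$, $n_1,\dots,n_k\ge 1$, and for each $i$ let $q_i=\sum_\alpha a_{i,\alpha}Z_\alpha$ be a positive regular polynomial in $n_i$ noncommuting indeterminates (finitely many nonzero coefficients, all $\ge 0$; zero constant term; nonzero coefficients of $Z_1,\dots,Z_{n_i}$). Let $\mathbb F_{n_i}^+$ be the free monoid on generators $g_1,\dots,g_{n_i}$. Put $b_{i,\emptyset}=1$ and, for a nonempty word $\alpha\in\mathbb F_{n_i}^+$, $b_{i,\alpha}=\sum a_{i,\gamma_1}\cdots a_{i,\gamma_m}$, the sum being over all $m\ge 1$ and all factorizations $\alpha=\gamma_1\cdots\gamma_m$ into nonempty words. For a complex Hilbert space $\mathcal H$ and a tuple $X=(X_1,\dots,X_k)$, $X_i=(X_{i,1},\dots,X_{i,n_i})\in B(\mathcal H)^{n_i}$, write $X_\alpha=X_{1,\alpha_1}\cdots X_{k,\alpha_k}$ for $\alpha=(\alpha_1,\dots,\alpha_k)\in\prod_i\mathbb F_{n_i}^+$, where $X_{i,g_{j_1}\cdots g_{j_m}}=X_{i,j_1}\cdots X_{i,j_m}$; put $\Phi_{q_i,X_i}(Y)=\sum_\beta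 a_{i,\beta}X_{i,\beta}YX_{i,\beta}^*$ and $\Delta^p_{q,X}=(\mathrm{id}-\Phi_{q_1,X_1})^{p_1}\circ\cdots\circ(\mathrm{id}-\Phi_{q_k,X_k})^{p_k}$. Let $D_q(\mathcal H)$ be the set of those $X$ such that the entries of $X_s$ commute with those of $X_t$ whenever $s\ne t$, $\Delta^p_{q,X}(I)\ge 0$ for all $p\in\{0,1\}^k$, and $\Delta^{(1,\dots,1)}_{q,X}(I)$ is positive and invertible. Let $D_q(\mathcal H)^-$ be its operator norm closure, and for $r=(r_1,\dots,r_k)$ with $r_i>0$ let $rX=(r_1X_1,\dots,r_kX_k)$. Let $\Lambda_p=\{\alpha:\ |\alpha_i|=p_i \text{ for all } i\}$ for $p\in\mathbb Z_+^k$. For a Hilbert space $\mathcal K$ and $A_{(\alpha)}\in B(\mathcal K)$, the formal power series $F=\sum_\alpha A_{(\alpha)}\otimes Z_\alpha$ is *free holomorphic on* $\rho D_q$ ($\rho_i>0$) if $$F(X)=\sum_{p\in\mathbb Z_+^k}\ \sum_{\alpha\in\Lambda_p}A_{(\alpha)}\otimes X_\alpha$$ converges (unconditionally, as a series indexed by $p$)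 in operator norm on $\mathcal K\otimes\mathcal H$ for every Hilbert space $\mathcal H$ and every $X\in\rho D_q(\mathcal H)$. The *universal model* $W=\{W_{i,j}\}$ acts on $\bigotimes_{i=1}^kF^2(H_{n_i})$, with orthonormal basis $e_\alpha=e^1_{\alpha_1}\otimes\cdots\otimes e^k_{\alpha_k}$, by $$W_{i,j}\,e_\alpha=\sqrt{b_{i,\alpha_i}/b_{i,g_j\alpha_i}}\;e_{(\alpha_1,\dots,g_j\alpha_i,\dots,\alpha_k)}.$$ *Claim.* Let $F$ be free holomorphic on $\rho D_q$ with coefficients $A_{(\alpha)}\in B(\mathcal K)$, let $0<r_i<\rho_i$ for all $i$, and put $$M(r)=\sup\{\|F(X)\|:\ X\in rD_q(\mathcal H)^-,\ \mathcal H \text{ a Hilbert space}\}.$$ Then $rD_q(\mathcal H)^-\subseteq\rho D_q(\mathcal H)$ for every $\mathcal H$, $rW$ belongs to $rD_q\bigl(\bigotimes_iF^2(H_{n_i})\bigr)^-$ (so that $F$ is defined at all these points), $M(r)<\infty$, and for every $p\in\mathbb Z_+^k$ $$\Bigl\|\sum_{\alpha\in\Lambda_p}\frac1{b_{1,\alpha_1}\cdots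 b_{k,\alpha_k}}A_{(\alpha)}^*A_{(\alpha)}\Bigr\|^{1/2}\le\frac{M(r)}{r_1^{p_1}\cdots r_k^{p_k}}.$$ Moreover $M(r)=\|F(rW)\|$. -/

import Mathlib

open scoped TensorProduct

noncomputable section

namespace RegularPolydomain

/-- The free monoid on `m` generators is realised as the lists over `Fin m`: the word
`g_{j₁} ⋯ g_{j_p}` is `[j₁, …, j_p]`, its length is the length of the list, the unit is `[]`,
and `g_j α` is `j :: α`. -/
abbrev Word (m : ℕ) : Type := List (Fin m)

/-- Multi-words `α = (α₁, …, α_k)`, with `α_i` a word in `n_i` generators. -/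
abbrev MultiWord {k : ℕ} (n : Fin k → ℕ) : Type := ∀ i, Word (n i)

/-- The finite set `Λ_p` of the multi-words `α` with `|α_i| = p_i` for every `i`. -/
def Lam {k : ℕ} (n : Fin k → ℕ) (p : Fin k → ℕ) : Finset (MultiWord n) :=
  Fintype.piFinset fun i =>
    (Finset.univ : Finset (Fin (p i) → Fin (n i))).map
      ⟨fun w => List.ofFn w, List.ofFn_injective⟩

theorem mem_Lam {k : ℕ} (n : Fin k → ℕ) (p : Fin k → ℕ) (α : MultiWord n) :
    α ∈ Lam n p ↔ ∀ i, (α i).length = p i := by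
  simp only [Lam, Fintype.mem_piFinset, Finset.mem_map, Finset.mem_univ, true_and,
    Function.Embedding.coeFn_mk]
  refine forall_congr' fun i => ⟨?_, ?_⟩
  · rintro ⟨w, hw⟩
    rw [← hw, List.length_ofFn]
  · intro h
    rw [← h]
    exact ⟨(α i).get, List.ofFn_get _⟩

/-- A positive regular polynomial `q = ∑ a_α Z_α` in `m` noncommuting indeterminates: finitely many
nonzero coefficients, all of them `≥ 0`, no constant term, and nonzero linear coefficients. -/
structure PosRegPoly (m : ℕ) where
  coeff : Word m →₀ ℝ
  nonneg : ∀ α, 0 ≤ coeff α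
  coeff_nil : coeff [] = 0
  coeff_linear : ∀ j, coeff [j] ≠ 0

namespace PosRegPoly

variable {m : ℕ} (q : PosRegPoly m)

/-- The coefficients `b_α`: the sum of `a_{γ₁} ⋯ a_{γ_p}` over all factorisations
`α = γ₁ ⋯ γ_p` into nonempty words. Such factorisations correspond to the compositions of `|α|`;
for the empty word there is exactly one, with no factor, so that `b_{[]} = 1`. -/
def b (α : Word m) : ℝ :=
  ∑ c : Composition α.length, ((α.splitWrtComposition c).map q.coeff).prod

theorem b_nil : q.b [] = 1 := by
  have h : ∀ c : Composition ([] : Word m).length,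
      ((([] : Word m).splitWrtComposition c).map q.coeff).prod = 1 := by
    intro c
    have hl : (([] : Word m).splitWrtComposition c).length = 0 := by
      rw [List.length_splitWrtComposition]
      exact Nat.le_zero.mp c.length_le
    rw [List.length_eq_zero_iff.mp hl]
    simp
  have hc : Fintype.card (Composition ([] : Word m).length) = 1 := by
    rw [composition_card]; rfl
  rw [b, Finset.sum_congr rfl fun c _ => h c, Finset.sum_const, Finset.card_univ, hc, one_smul]

theorem linear_pos (j : Fin m) : 0 < q.coeff [j] :=
  lt_of_le_of_ne (q.nonneg _) (q.coeff_linear j).symm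

/-- Adding a first block of size one to a composition. -/
def consOne {l : ℕ} (c : Composition l) : Composition (l + 1) where
  blocks := 1 :: c.blocks
  blocks_pos := by
    intro i hi
    rcases List.mem_cons.mp hi with h | h
    · omega
    · exact c.blocks_pos h
  blocks_sum := by simp [c.blocks_sum, add_comm]

theorem b_cons_ge (j : Fin m) (α : Word m) : q.coeff [j] * q.b α ≤ q.b (j :: α) := by
  have hinj : Function.Injective (consOne (l := α.length)) := by
    intro c d h
    have := congrArg Composition.blocks h
    exact Composition.ext (by simpa [consOne] using this)
  have hterm : ∀ c : Composition α.length,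
      (((j :: α : Word m).splitWrtComposition (consOne c)).map q.coeff).prod =
        q.coeff [j] * ((α.splitWrtComposition c).map q.coeff).prod := by
    intro c
    simp [List.splitWrtComposition, consOne, List.splitWrtCompositionAux_cons]
  have hnn : ∀ d : Composition (j :: α : Word m).length,
      0 ≤ (((j :: α : Word m).splitWrtComposition d).map q.coeff).prod := by
    intro d
    refine List.prod_nonneg fun x hx => ?_
    obtain ⟨γ, -, rfl⟩ := List.mem_map.mp hx
    exact q.nonneg γ
  calc q.coeff [j] * q.b α
      = ∑ c : Composition α.length,
          (((j :: α : Word m).splitWrtComposition (consOne c)).map q.coeff).prod := by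
        rw [b, Finset.mul_sum]
        exact Finset.sum_congr rfl fun c _ => (hterm c).symm
    _ = ∑ d ∈ Finset.univ.map ⟨consOne, hinj⟩,
          (((j :: α : Word m).splitWrtComposition d).map q.coeff).prod := by
        rw [Finset.sum_map]; rfl
    _ ≤ q.b (j :: α) :=
        Finset.sum_le_sum_of_subset_of_nonneg (Finset.subset_univ _) fun d _ _ => hnn d

theorem b_pos (α : Word m) : 0 < q.b α := by
  induction α with
  | nil => rw [b_nil]; exact one_pos
  | cons j α ih => exact lt_of_lt_of_le (mul_pos (q.linear_pos j) ih) (q.b_cons_ge j α)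

theorem weight_le (j : Fin m) (α : Word m) :
    √(q.b α) / √(q.b (j :: α)) ≤ 1 / √(q.coeff [j]) := by
  rw [div_le_div_iff₀ (Real.sqrt_pos.mpr (q.b_pos _)) (Real.sqrt_pos.mpr (q.linear_pos j)),
    one_mul, mul_comm, ← Real.sqrt_mul (q.nonneg _)]
  exact Real.sqrt_le_sqrt (q.b_cons_ge j α)

end PosRegPoly

section Operators

variable {H : Type*} [NormedAddCommGroup H] [InnerProductSpace ℂ H]

/-- `A_α = A_{j₁} ⋯ A_{j_p}` for a word `α = g_{j₁} ⋯ g_{j_p}`. -/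
def wordEval {m : ℕ} (A : Fin m → (H →L[ℂ] H)) (α : Word m) : H →L[ℂ] H :=
  (α.map A).prod

/-- `X_α = X_{1,α₁} ⋯ X_{k,α_k}` for a multi-word `α`. -/
def multiEval {k : ℕ} {n : Fin k → ℕ} (X : ∀ i, Fin (n i) → (H →L[ℂ] H)) (α : MultiWord n) :
    H →L[ℂ] H :=
  (List.ofFn fun i => wordEval (X i) (α i)).prod

/-- The tuple `rX = (r₁ X₁, …, r_k X_k)`. -/
def scale {k : ℕ} {n : Fin k → ℕ} (r : Fin k → ℝ) (X : ∀ i, Fin (n i) → (H →L[ℂ] H)) :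
    ∀ i, Fin (n i) → (H →L[ℂ] H) :=
  fun i j => (r i : ℂ) • X i j

variable [CompleteSpace H]

/-- The map `Φ_{q,A}(Y) = ∑ a_α A_α Y A_α^*` on `B(H)`. -/
def Phi {m : ℕ} (q : PosRegPoly m) (A : Fin m → (H →L[ℂ] H)) :
    Module.End ℂ (H →L[ℂ] H) where
  toFun Y := ∑ α ∈ q.coeff.support,
    (q.coeff α : ℂ) • (wordEval A α * Y * ContinuousLinearMap.adjoint (wordEval A α))
  map_add' Y Z := by
    simp only [mul_add, add_mul, smul_add, Finset.sum_add_distrib]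
  map_smul' c Y := by
    simp only [mul_smul_comm, smul_mul_assoc, Finset.smul_sum, RingHom.id_apply]
    exact Finset.sum_congr rfl fun α _ => smul_comm _ _ _

/-- The defect mapping `Δ^p_{q,X} = (id - Φ_{q₁,X₁})^{p₁} ∘ ⋯ ∘ (id - Φ_{q_k,X_k})^{p_k}`. -/
def defect {k : ℕ} {n : Fin k → ℕ} (q : ∀ i, PosRegPoly (n i))
    (X : ∀ i, Fin (n i) → (H →L[ℂ] H)) (p : Fin k → ℕ) : Module.End ℂ (H →L[ℂ] H) :=
  (List.ofFn fun i => (1 - Phi (q i) (X i)) ^ p i).prod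

end Operators

/-- The closed-type regular polydomain: the entries of `X_s` and `X_t` commute for `s ≠ t`, and
`Δ^p_{q,X}(I) ≥ 0` for all `p ∈ {0,1}^k`. -/
def closedPolydomain {k : ℕ} {n : Fin k → ℕ} (q : ∀ i, PosRegPoly (n i))
    (H : Type*) [NormedAddCommGroup H] [InnerProductSpace ℂ H] [CompleteSpace H] :
    Set (∀ i, Fin (n i) → (H →L[ℂ] H)) :=
  {X | (∀ s t, s ≠ t → ∀ a c, Commute (X s a) (X t c)) ∧
    ∀ p : Fin k → ℕ, (∀ i, p i ≤ 1) → (defect q X p 1).IsPositive}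

/-- The open regular polydomain `D_q(H)`: those `X` in the closed-type polydomain for which
`Δ_{q,X}(I)` (all exponents equal to one) is positive and invertible. -/
def polydomain {k : ℕ} {n : Fin k → ℕ} (q : ∀ i, PosRegPoly (n i))
    (H : Type*) [NormedAddCommGroup H] [InnerProductSpace ℂ H] [CompleteSpace H] :
    Set (∀ i, Fin (n i) → (H →L[ℂ] H)) :=
  {X | X ∈ closedPolydomain q H ∧
    (defect q X (fun _ => 1) 1).IsPositive ∧ IsUnit (defect q X (fun _ => 1) 1)}

section Shift

variable {ι : Type*} {f : ι → ι} {w : ι → ℝ} {C : ℝ}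

theorem shift_summable (hf : Function.Injective f) (hw : ∀ a, |w a| ≤ C)
    (x : lp (fun _ : ι => ℂ) 2) :
    (Summable fun b => ‖Function.extend f (fun a => (w a : ℂ) * x a) 0 b‖ ^ (2 : ℝ)) ∧
      ∑' b, ‖Function.extend f (fun a => (w a : ℂ) * x a) 0 b‖ ^ (2 : ℝ) ≤
        (C * ‖x‖) ^ (2 : ℝ) := by
  have h2 : (0 : ℝ) < (2 : ENNReal).toReal := by norm_num
  have hx : Summable fun a => ‖x a‖ ^ (2 : ℝ) := by
    simpa using (lp.memℓp x).summable h2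
  have hxn : ‖x‖ ^ (2 : ℝ) = ∑' a, ‖x a‖ ^ (2 : ℝ) := by
    simpa using lp.norm_rpow_eq_tsum h2 x
  have hle : ∀ a, ‖(w a : ℂ) * x a‖ ^ (2 : ℝ) ≤ C ^ (2 : ℝ) * ‖x a‖ ^ (2 : ℝ) := by
    intro a
    have hC : 0 ≤ C := (abs_nonneg _).trans (hw a)
    rw [← Real.mul_rpow hC (norm_nonneg _), norm_mul, Complex.norm_real, Real.norm_eq_abs]
    gcongr
    exact hw a
  have hs : Summable fun a => ‖(w a : ℂ) * x a‖ ^ (2 : ℝ) :=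
    Summable.of_nonneg_of_le (fun a => by positivity) hle (hx.mul_left _)
  have hcomp : (fun b => ‖Function.extend f (fun a => (w a : ℂ) * x a) 0 b‖ ^ (2 : ℝ)) ∘ f =
      fun a => ‖(w a : ℂ) * x a‖ ^ (2 : ℝ) := by
    funext a
    simp [hf.extend_apply]
  have hzero : ∀ b ∉ Set.range f,
      ‖Function.extend f (fun a => (w a : ℂ) * x a) 0 b‖ ^ (2 : ℝ) = 0 := by
    intro b hb
    rw [Function.extend_apply' _ _ _ (by simpa using hb)]
    simp
  refine ⟨(hf.summable_iff hzero).mp (by rw [hcomp]; exact hs), ?_⟩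
  have ht : ∑' b, ‖Function.extend f (fun a => (w a : ℂ) * x a) 0 b‖ ^ (2 : ℝ) =
      ∑' a, ‖(w a : ℂ) * x a‖ ^ (2 : ℝ) := by
    rw [← hcomp]
    exact (hf.tsum_eq (Function.support_subset_iff'.mpr hzero)).symm
  rw [ht]
  rcases isEmpty_or_nonempty ι with he | ⟨⟨a₀⟩⟩
  · simp only [tsum_empty]
    exact Real.rpow_two (C * ‖x‖) ▸ sq_nonneg _
  · have hC : 0 ≤ C := (abs_nonneg _).trans (hw a₀)
    rw [Real.mul_rpow hC (norm_nonneg _), hxn, ← tsum_mul_left]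
    exact hs.tsum_le_tsum hle (hx.mul_left _)

/-- The bounded operator on `ℓ²(ι)` with `e_a ↦ w_a e_{f(a)}`, for `f` injective and `w` bounded. -/
def weightedShift (f : ι → ι) (w : ι → ℝ) (C : ℝ) (hf : Function.Injective f)
    (hw : ∀ a, |w a| ≤ C) : lp (fun _ : ι => ℂ) 2 →L[ℂ] lp (fun _ : ι => ℂ) 2 :=
  LinearMap.mkContinuous
    { toFun := fun x => ⟨Function.extend f (fun a => (w a : ℂ) * x a) 0,
        memℓp_gen (by simpa using (shift_summable hf hw x).1)⟩
      map_add' := by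
        intro x y
        ext b
        by_cases hb : ∃ a, f a = b
        · obtain ⟨a, rfl⟩ := hb
          simp only [lp.coeFn_add, Pi.add_apply, hf.extend_apply, mul_add]
        · simp only [lp.coeFn_add, Pi.add_apply, Function.extend_apply' _ _ _ hb, Pi.zero_apply,
            add_zero]
      map_smul' := by
        intro c x
        ext b
        by_cases hb : ∃ a, f a = b
        · obtain ⟨a, rfl⟩ := hb
          simp [hf.extend_apply, mul_left_comm]
        · simp [Function.extend_apply' _ _ _ hb] }
    |C| (by
      intro x
      refine lp.norm_le_of_tsum_le (by norm_num) (by positivity) ?_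
      have hw' : ∀ a, |w a| ≤ |C| := fun a => (hw a).trans (le_abs_self C)
      simpa using (shift_summable hf hw' x).2)

theorem weightedShift_single [DecidableEq ι] (hf : Function.Injective f) (hw : ∀ a, |w a| ≤ C)
    (a : ι) :
    weightedShift f w C hf hw (lp.single 2 a 1) = (w a : ℂ) • lp.single 2 (f a) 1 := by
  ext b
  rw [lp.coeFn_smul, Pi.smul_apply]
  change Function.extend f (fun c => (w c : ℂ) * (lp.single 2 a (1 : ℂ) : ι → ℂ) c) 0 b = _
  by_cases hb : ∃ a', f a' = b
  · obtain ⟨a', rfl⟩ := hb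
    rw [hf.extend_apply]
    by_cases h : a' = a
    · subst h
      simp
    · have h' : f a' ≠ f a := fun e => h (hf e)
      simp [h, h']
  · have h' : b ≠ f a := fun e => hb ⟨a, e.symm⟩
    rw [Function.extend_apply' _ _ _ hb]
    simp [h']

end Shift

section Fock

universe v

variable {k : ℕ} {n : Fin k → ℕ}

/-- Multi-words, as a type in the universe `v` of the Hilbert spaces under consideration. -/
abbrev FockIndex (n : Fin k → ℕ) : Type v := ULift.{v} (MultiWord n)

/-- The Hilbert space `F²(H_{n₁}) ⊗ ⋯ ⊗ F²(H_{n_k})`, given through its orthonormal basis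
`e_α = e¹_{α₁} ⊗ ⋯ ⊗ e^k_{α_k}`, `α` a multi-word. -/
abbrev Fock (n : Fin k → ℕ) : Type v := lp (fun _ : FockIndex.{v} n => ℂ) 2

/-- The multi-word `(α₁, …, g_j α_i, …, α_k)`. -/
def consAt (i : Fin k) (j : Fin (n i)) (α : FockIndex.{v} n) : FockIndex.{v} n :=
  ULift.up (Function.update α.down i (j :: α.down i))

theorem consAt_injective (i : Fin k) (j : Fin (n i)) :
    Function.Injective (consAt.{v} (n := n) i j) := by
  intro α β h
  have h' : Function.update α.down i (j :: α.down i) =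
      Function.update β.down i (j :: β.down i) := congrArg ULift.down h
  refine ULift.ext _ _ (funext fun s => ?_)
  by_cases hs : s = i
  · subst hs
    have := congrFun h' s
    simpa using this
  · have := congrFun h' s
    simpa [Function.update_of_ne hs] using this

/-- The universal model `W = {W_{i,j}}`: the operator `I ⊗ ⋯ ⊗ W_{i,j} ⊗ ⋯ ⊗ I`, which sends
`e_{(α₁, …, α_k)}` to `√b_{i,α_i} / √b_{i,g_j α_i} · e_{(α₁, …, g_j α_i, …, α_k)}`. -/
def universalModel (q : ∀ i, PosRegPoly (n i)) :
    ∀ i, Fin (n i) → (Fock.{v} n →L[ℂ] Fock.{v} n) :=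
  fun i j => weightedShift (consAt i j)
    (fun α => √((q i).b (α.down i)) / √((q i).b (j :: α.down i)))
    (1 / √((q i).coeff [j])) (consAt_injective i j) (fun α => by
      rw [abs_of_nonneg (by positivity)]
      exact (q i).weight_le j (α.down i))

theorem universalModel_single [DecidableEq (FockIndex.{v} n)] (q : ∀ i, PosRegPoly (n i))
    (i : Fin k) (j : Fin (n i)) (α : FockIndex.{v} n) :
    universalModel q i j (lp.single 2 α 1) =
      ((√((q i).b (α.down i)) / √((q i).b (j :: α.down i)) : ℝ) : ℂ) •
        lp.single 2 (consAt i j α) 1 :=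
  weightedShift_single _ _ _

end Fock

section Holomorphic

universe u v

variable {k : ℕ} {n : Fin k → ℕ} {K : Type u} [NormedAddCommGroup K] [InnerProductSpace ℂ K]

/-- The Hilbert space tensor product. -/
abbrev HilbertTensor (K : Type u) [NormedAddCommGroup K] [InnerProductSpace ℂ K]
    (H : Type v) [NormedAddCommGroup H] [InnerProductSpace ℂ H] : Type (max u v) :=
  UniformSpace.Completion (K ⊗[ℂ] H)

/-- The bounded operator `A ⊗ X` on the Hilbert space tensor product `K ⊗ H`. -/
def opTensor {H : Type v} [NormedAddCommGroup H] [InnerProductSpace ℂ H]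
    (A : K →L[ℂ] K) (X : H →L[ℂ] H) : HilbertTensor K H →L[ℂ] HilbertTensor K H :=
  (TensorProduct.mapL A X).completion

/-- The multi-homogeneous part `∑_{α ∈ Λ_p} A_(α) ⊗ X_α` of a formal power series with operator
coefficients `A_(α) ∈ B(K)`. -/
def homogPart (A : MultiWord n → (K →L[ℂ] K)) {H : Type v} [NormedAddCommGroup H]
    [InnerProductSpace ℂ H] (X : ∀ i, Fin (n i) → (H →L[ℂ] H)) (p : Fin k → ℕ) :
    HilbertTensor K H →L[ℂ] HilbertTensor K H :=
  ∑ α ∈ Lam n p, opTensor (A α) (multiEval X α)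

/-- The value `F(X) = ∑_{p} ∑_{α ∈ Λ_p} A_(α) ⊗ X_α` (operator norm topology). -/
def seriesEval (A : MultiWord n → (K →L[ℂ] K)) {H : Type v} [NormedAddCommGroup H]
    [InnerProductSpace ℂ H] (X : ∀ i, Fin (n i) → (H →L[ℂ] H)) :
    HilbertTensor K H →L[ℂ] HilbertTensor K H :=
  ∑' p : Fin k → ℕ, homogPart A X p

/-- The formal power series with coefficients `A_(α)` is a free holomorphic function on the
abstract polydomain `ρ D_q`: its series of multi-homogeneous parts converges in operator norm at
every `X ∈ ρ D_q(H)`, for every Hilbert space `H`. -/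
def IsFreeHolomorphic (q : ∀ i, PosRegPoly (n i)) (ρ : Fin k → ℝ)
    (A : MultiWord n → (K →L[ℂ] K)) : Prop :=
  ∀ (H : Type v) [NormedAddCommGroup H] [InnerProductSpace ℂ H] [CompleteSpace H],
    ∀ X ∈ scale ρ '' polydomain q H, Summable fun p : Fin k → ℕ => homogPart A X p

/-- The set of all `‖F(X)‖`, `X ∈ r D_q(H)⁻` (norm closure), `H` any Hilbert space. -/
def normValues (q : ∀ i, PosRegPoly (n i)) (r : Fin k → ℝ)
    (A : MultiWord n → (K →L[ℂ] K)) : Set ℝ :=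
  {c | ∃ (H : Type v) (_ : NormedAddCommGroup H) (_ : InnerProductSpace ℂ H)
    (_ : CompleteSpace H), ∃ X ∈ scale r '' closure (polydomain q H), c = ‖seriesEval A X‖}

/-- `M(r) = sup ‖F(X)‖` over all `X ∈ r D_q(H)⁻` and all Hilbert spaces `H`. -/
def supNorm (q : ∀ i, PosRegPoly (n i)) (r : Fin k → ℝ) (A : MultiWord n → (K →L[ℂ] K)) : ℝ :=
  sSup (normValues.{u, v} q r A)

/-- The operator `∑_{α ∈ Λ_p} (b_{1,α₁} ⋯ b_{k,α_k})⁻¹ A_(α)^* A_(α)`. -/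
def coeffGram [CompleteSpace K] (q : ∀ i, PosRegPoly (n i)) (A : MultiWord n → (K →L[ℂ] K))
    (p : Fin k → ℕ) : K →L[ℂ] K :=
  ∑ α ∈ Lam n p, (((∏ i, (q i).b (α i))⁻¹ : ℝ) : ℂ) •
    (ContinuousLinearMap.adjoint (A α) * A α)

end Holomorphic

end RegularPolydomain

end

universe u v

open RegularPolydomain

noncomputable section

namespace RegularPolydomain

/-! The norm closure of $D_q$ is `closedPolydomain`: scaling one of its elements by factors $t_i<1$
makes the defect at $I$ at least $\prod_i(1-t_i)^{p_i}$, so the result lies in $D_q$, and $t\to1$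
recovers the element. Scaling by $r_i/\rho_i$ gives $rD_q^-\subseteq\rho D_q$. The model $W$ lies in
`closedPolydomain` because its defects are coordinate projections.

The model dominates every other point. For $Z=tX$ write $\Delta_Z(I)=B^*B$. The Poisson kernel
$h\mapsto\sum_\alpha\sqrt{b_\alpha}\,e_\alpha\otimes BZ_\alpha^*h$ is isometric, because
$\sum_\alpha b_\alpha Z_\alpha\Delta_Z(I)Z_\alpha^*=I$ (`tsum_quad_defect`), and it intertwines
$Z_{i,j}^*$ with $W_{i,j}^*\otimes I$ (`exists_dilation`). This gives a von Neumann inequality for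
polynomials with operator coefficients (`norm_sum_homogPart_le`), first for $tX$, then for $X$ as
$t\to1$, then for convergent series. Since $rW$ is itself a competitor, $M(r)=\|F(rW)\|$.

For the Cauchy inequality, apply $F(rW)$ to $a\otimes e_\emptyset$. The component of multidegree $p$
is $r^p\sum_{\alpha\in\Lambda_p}A_{(\alpha)}a\otimes b_\alpha^{-1/2}e_\alpha$; different degrees are
orthogonal, and the squared norm of this sum without $r^p$ is $\langle\,$`coeffGram`$\,a,a\rangle$.

The combinatorics is the recursion for $b$, split at the first factor (for the defects of $W$) or at
the last (for the Poisson kernel). -/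

theorem tsum_list_ennreal {α : Type*} (f : List α → ENNReal) :
    ∑' L, f L = f [] + ∑' a, ∑' L, f (a :: L) := by
  let e : Option (α × List α) ≃ List α :=
    { toFun := fun o => o.elim [] fun x => x.1 :: x.2
      invFun := fun L => match L with
        | [] => none
        | a :: L => some (a, L)
      left_inv := by rintro (_ | ⟨a, L⟩) <;> rfl
      right_inv := by rintro (_ | ⟨a, L⟩) <;> rfl }
  rw [← e.tsum_eq, ← (Equiv.optionEquivSumPUnit.{0} (α × List α)).symm.tsum_eq,
    Summable.tsum_sum ENNReal.summable ENNReal.summable, add_comm, ENNReal.tsum_prod']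
  simp [e]

/-! ### Recursions for the coefficients $b_\alpha$. -/

namespace PosRegPoly

variable {m : ℕ} (q : PosRegPoly m)

/-- The functional `u ↦ ∑ b_α u(α)` on `[0, ∞]`-valued functions of words. -/
def wsum (u : Word m → ENNReal) : ENNReal := ∑' α, ENNReal.ofReal (q.b α) * u α

theorem wsum_mono {u w : Word m → ENNReal} (h : ∀ α, u α ≤ w α) : q.wsum u ≤ q.wsum w :=
  ENNReal.tsum_le_tsum fun α => mul_le_mul_right (h α) _

theorem wsum_add (u w : Word m → ENNReal) :
    q.wsum (fun α => u α + w α) = q.wsum u + q.wsum w := by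
  simp only [wsum, mul_add, ENNReal.tsum_add]

theorem wsum_const_mul (c : ENNReal) (u : Word m → ENNReal) :
    q.wsum (fun α => c * u α) = c * q.wsum u := by
  simp only [wsum, mul_left_comm _ c, ENNReal.tsum_mul_left]

theorem wsum_tsum {ι : Type*} (u : ι → Word m → ENNReal) :
    q.wsum (fun α => ∑' i, u i α) = ∑' i, q.wsum (u i) := by
  simp only [wsum, ← ENNReal.tsum_mul_left]
  exact ENNReal.tsum_comm

/-- A word with a composition of its length is a list of nonempty words; lists containing the empty
word contribute nothing, as $q$ has no constant term. -/
theorem wsum_eq_tsum_list (u : Word m → ENNReal) :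
    q.wsum u = ∑' L : List (Word m),
      (L.map fun β => ENNReal.ofReal (q.coeff β)).prod * u L.flatten := by
  let g : (Σ α : Word m, Composition α.length) → List (Word m) :=
    fun x => x.1.splitWrtComposition x.2
  have hg : Function.Injective g := by
    rintro ⟨α, c⟩ ⟨β, d⟩ h
    have hfl : α = β := by
      rw [← List.flatten_splitWrtComposition α c, ← List.flatten_splitWrtComposition β d]
      exact congrArg List.flatten h
    subst hfl
    have : c = d := by
      apply Composition.ext
      rw [← List.map_length_splitWrtComposition α c, ← List.map_length_splitWrtComposition α d]
      exact congrArg (List.map List.length) h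
    rw [this]
  have hsupp : Function.support (fun L : List (Word m) =>
      (L.map fun β => ENNReal.ofReal (q.coeff β)).prod * u L.flatten) ⊆ Set.range g := by
    intro L hL
    have hne : ∀ β ∈ L, 0 < β.length := by
      intro β hβ
      by_contra h0
      have hb : β = [] := List.length_eq_zero_iff.mp (by omega)
      apply hL
      have : (L.map fun β => ENNReal.ofReal (q.coeff β)).prod = 0 := by
        apply List.prod_eq_zero
        exact List.mem_map.mpr ⟨β, hβ, by simp [hb, q.coeff_nil]⟩
      simp [this]
    refine ⟨⟨L.flatten, ⟨L.map List.length, ?_, ?_⟩⟩, ?_⟩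
    · intro i hi
      obtain ⟨β, hβ, rfl⟩ := List.mem_map.mp hi
      exact hne β hβ
    · rw [List.length_flatten]
    · exact List.splitWrtComposition_flatten L _ rfl
  rw [← hg.tsum_eq hsupp, ENNReal.tsum_sigma']
  refine tsum_congr fun α => ?_
  rw [tsum_fintype, b, ENNReal.ofReal_sum_of_nonneg, Finset.sum_mul]
  · refine Finset.sum_congr rfl fun c _ => ?_
    simp only [g, List.flatten_splitWrtComposition]
    congr 1
    generalize α.splitWrtComposition c = L
    induction L with
    | nil => simp
    | cons a L ih => simp [ENNReal.ofReal_mul (q.nonneg a), ih]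
  · intro d _
    refine List.prod_nonneg fun x hx => ?_
    obtain ⟨γ, -, rfl⟩ := List.mem_map.mp hx
    exact q.nonneg γ

/-- The formal identity $b=1+qb$, from splitting off the first word of the list. -/
theorem wsum_eq_first (u : Word m → ENNReal) :
    q.wsum u = u [] + ∑ β ∈ q.coeff.support,
      ENNReal.ofReal (q.coeff β) * q.wsum fun γ => u (β ++ γ) := by
  rw [wsum_eq_tsum_list, tsum_list_ennreal]
  congr 1
  · simp
  · rw [tsum_eq_sum (s := q.coeff.support)]
    · refine Finset.sum_congr rfl fun β _ => ?_
      rw [wsum_eq_tsum_list, ← ENNReal.tsum_mul_left]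
      exact tsum_congr fun L => by simp [mul_assoc]
    · intro β hβ
      simp [Finsupp.notMem_support_iff.mp hβ]

theorem ne_nil_of_mem_support {β : Word m} (h : β ∈ q.coeff.support) : β ≠ [] := by
  rintro rfl
  exact Finsupp.mem_support_iff.mp h q.coeff_nil

/-- The right translate `γ ↦ ∑ a_β u(γβ)` of `u` by the coefficients of `q`. -/
def rightTranslate (u : Word m → ENNReal) (γ : Word m) : ENNReal :=
  ∑ β ∈ q.coeff.support, ENNReal.ofReal (q.coeff β) * u (γ ++ β)

/-- The mirror identity $b=1+bq$, deduced from $b=1+qb$ without reversing words: since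
$\beta\ne\emptyset$, the function $\gamma\mapsto u(\beta\gamma)$ has strictly shorter support, and
the induction applies to it. -/
theorem wsum_eq_last_of_support (N : ℕ) (u : Word m → ENNReal) (hu : ∀ α, N ≤ α.length → u α = 0) :
    q.wsum u = u [] + q.wsum (q.rightTranslate u) := by
  induction N generalizing u with
  | zero =>
    have : u = fun _ => 0 := funext fun α => hu α (Nat.zero_le _)
    subst this
    simp [wsum, rightTranslate]
  | succ N ih =>
    rw [wsum_eq_first q u, wsum_eq_first q (q.rightTranslate u)]
    congr 1
    conv_rhs => rw [rightTranslate]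
    rw [← Finset.sum_add_distrib]
    refine Finset.sum_congr rfl fun β hβ => ?_
    have hpos : 0 < β.length := List.length_pos_iff.mpr (q.ne_nil_of_mem_support hβ)
    rw [ih (fun γ => u (β ++ γ)), mul_add]
    · simp [rightTranslate, List.append_assoc]
      rfl
    · intro α hα
      exact hu _ (by rw [List.length_append]; omega)

theorem wsum_eq_last (u : Word m → ENNReal) :
    q.wsum u = u [] + q.wsum (q.rightTranslate u) := by
  classical
  -- Cutting $u$ by word length reduces to bounded support; in $[0,\infty]$ all sums may be
  -- exchanged.
  let w : ℕ → Word m → ENNReal := fun N α => if α.length = N then u α else 0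
  have hw : u = fun α => ∑' N, w N α := by
    funext α
    rw [tsum_eq_single α.length]
    · simp [w]
    · intro N hN
      simp [w, hN.symm]
  have hN : ∀ N, q.wsum (w N) = w N [] + q.wsum (q.rightTranslate (w N)) := fun N =>
    q.wsum_eq_last_of_support (N + 1) _ fun α hα => if_neg (by omega)
  have hr : q.rightTranslate u = fun α => ∑' N, q.rightTranslate (w N) α := by
    funext γ
    simp only [rightTranslate]
    rw [Summable.tsum_finsetSum fun _ _ => ENNReal.summable]
    refine Finset.sum_congr rfl fun β _ => ?_
    rw [ENNReal.tsum_mul_left]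
    conv_lhs => rw [hw]
  rw [hr, wsum_tsum]
  conv_lhs => rw [hw]
  rw [wsum_tsum, tsum_congr hN, ENNReal.tsum_add]
  congr 1
  exact (congrFun hw []).symm

/-- If `u = w + R u`, where `R` is the right translation, then `∑ b_α w(α) ≤ u(∅)`. -/
theorem wsum_le_of_eq_add {u w : Word m → ENNReal} (hu : ∀ α, u α ≠ ⊤)
    (h : ∀ α, u α = w α + q.rightTranslate u α) : q.wsum w ≤ u [] := by
  classical
  -- Since `q.wsum u` may be infinite, cancellation is done after truncating to words of length
  -- $<N$, where `q.wsum rN` is a finite sum.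
  have key : ∀ N, q.wsum (fun α => if α.length < N then w α else 0) ≤ u [] := by
    intro N
    set uN : Word m → ENNReal := fun α => if α.length < N then u α else 0 with huN
    set rN : Word m → ENNReal := fun α => if α.length < N then q.rightTranslate u α else 0
    -- Right translation evaluates $u$ at longer words only, so translating the truncation loses
    -- mass compared with truncating the translate.
    have hle : q.wsum (q.rightTranslate uN) ≤ q.wsum rN := by
      refine q.wsum_mono fun α => ?_
      simp only [rN, rightTranslate]
      split_ifs with hα
      · refine Finset.sum_le_sum fun β _ => mul_le_mul_right ?_ _
        simp only [huN]
        split_ifs <;> simp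
      · refine (Finset.sum_eq_zero fun β _ => ?_).le
        rw [huN]
        simp only [List.length_append]
        rw [if_neg (by omega), mul_zero]
    have h1 : q.wsum (fun α => if α.length < N then w α else 0) + q.wsum rN ≤ u [] + q.wsum rN := by
      rw [← wsum_add]
      have : (fun α : Word m => (if α.length < N then w α else 0) + rN α) = uN := by
        funext α
        simp only [rN, huN]
        split_ifs
        · exact (h α).symm
        · simp
      rw [this, q.wsum_eq_last_of_support N uN fun α hα => if_neg (by omega)]
      refine add_le_add ?_ hle
      simp only [huN]
      split_ifs <;> simp
    have hfin : q.wsum rN ≠ ⊤ := by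
      let s : Set (Word m) := {α | α.length < N}
      have hs : s.Finite := List.finite_length_lt (Fin m) N
      rw [wsum, tsum_eq_sum (s := hs.toFinset)]
      · refine ENNReal.sum_ne_top.mpr fun α _ => ENNReal.mul_ne_top ENNReal.ofReal_ne_top ?_
        simp only [rN]
        split_ifs
        · exact ne_top_of_le_ne_top (hu α) (by rw [h α]; exact le_add_self)
        · simp
      · intro α hα
        have : ¬ α.length < N := fun h' => hα (hs.mem_toFinset.mpr h')
        simp [rN, this]
    exact (ENNReal.add_le_add_iff_right hfin).mp h1
  refine ENNReal.summable.tsum_le_of_sum_le fun s => ?_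
  refine le_trans ?_ (key (s.sup List.length + 1))
  rw [wsum]
  refine le_trans (Finset.sum_le_sum fun α hα => ?_) (ENNReal.sum_le_tsum s)
  rw [if_pos (Nat.lt_succ_of_le (Finset.le_sup hα))]

/-- With `q.wsum u` finite, the translate can be cancelled directly, without truncation. -/
theorem wsum_eq_of_eq_add {u w : Word m → ENNReal} (hu : q.wsum u ≠ ⊤)
    (h : ∀ α, u α = w α + q.rightTranslate u α) : q.wsum w = u [] := by
  have h1 : q.wsum u = q.wsum w + q.wsum (q.rightTranslate u) := by
    rw [← wsum_add]
    exact congrArg _ (funext h)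
  have h2 := q.wsum_eq_last u
  have h3 : q.wsum (q.rightTranslate u) ≠ ⊤ :=
    ne_top_of_le_ne_top hu (by rw [h1]; exact le_add_self)
  rw [h1] at h2
  exact (ENNReal.add_left_inj h3).mp h2

-- The first-factor identity tested on the indicator of $\alpha$; it is what computes the defects of
-- $W$.
open Classical in
theorem b_eq (α : Word m) :
    q.b α = (if α = [] then 1 else 0) + ∑ β ∈ q.coeff.support,
      q.coeff β * (if β <+: α then q.b (α.drop β.length) else 0) := by
  have hsingle : ∀ α : Word m, q.wsum (fun γ => if γ = α then 1 else 0) = ENNReal.ofReal (q.b α) := by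
    intro α
    rw [wsum, tsum_eq_single α]
    · simp
    · intro γ hγ
      simp [hγ]
  have hnn : ∀ β : Word m, 0 ≤ if β <+: α then q.b (α.drop β.length) else 0 := by
    intro β
    split_ifs
    · exact (q.b_pos _).le
    · rfl
  have h := q.wsum_eq_first (fun γ => if γ = α then 1 else 0)
  rw [hsingle] at h
  have h2 : ∀ β ∈ q.coeff.support, ENNReal.ofReal (q.coeff β) *
      q.wsum (fun γ => if β ++ γ = α then 1 else 0) =
      ENNReal.ofReal (q.coeff β * (if β <+: α then q.b (α.drop β.length) else 0)) := by
    intro β _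
    rw [ENNReal.ofReal_mul (q.nonneg β)]
    congr 1
    split_ifs with hp
    · obtain ⟨γ₀, rfl⟩ := hp
      simp [hsingle]
    · have : ∀ γ, ¬ β ++ γ = α := fun γ hγ => hp ⟨γ, hγ⟩
      simp [wsum, this]
  rw [Finset.sum_congr rfl h2, ← ENNReal.ofReal_sum_of_nonneg
    (fun β _ => mul_nonneg (q.nonneg β) (hnn β))] at h
  have h3 : (if [] = α then 1 else 0 : ENNReal) = ENNReal.ofReal (if α = [] then 1 else 0) := by
    by_cases hα : α = []
    · simp [hα]
    · simp [hα, Ne.symm hα]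
  rw [h3, ← ENNReal.ofReal_add (by split_ifs <;> simp)
    (Finset.sum_nonneg fun β _ => mul_nonneg (q.nonneg β) (hnn β))] at h
  rwa [ENNReal.ofReal_eq_ofReal_iff (q.b_pos α).le] at h
  exact add_nonneg (by split_ifs <;> simp)
    (Finset.sum_nonneg fun β _ => mul_nonneg (q.nonneg β) (hnn β))

end PosRegPoly

/-! ### The maps $\Phi$ and the effect of scaling on defects. -/

section Maps

variable {H : Type*} [NormedAddCommGroup H] [InnerProductSpace ℂ H]

theorem wordEval_nil {m : ℕ} (A : Fin m → (H →L[ℂ] H)) : wordEval A [] = 1 := rfl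

theorem wordEval_cons {m : ℕ} (A : Fin m → (H →L[ℂ] H)) (j : Fin m) (α : Word m) :
    wordEval A (j :: α) = A j * wordEval A α := List.prod_cons

theorem wordEval_append {m : ℕ} (A : Fin m → (H →L[ℂ] H)) (α β : Word m) :
    wordEval A (α ++ β) = wordEval A α * wordEval A β := by
  rw [wordEval, List.map_append, List.prod_append]; rfl

theorem wordEval_smul {m : ℕ} (t : ℂ) (A : Fin m → (H →L[ℂ] H)) (α : Word m) :
    wordEval (fun j => t • A j) α = t ^ α.length • wordEval A α := by
  induction α with
  | nil => simp [wordEval_nil]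
  | cons j α ih =>
    rw [wordEval_cons, wordEval_cons, ih, smul_mul_smul_comm, List.length_cons, pow_succ']

theorem commute_wordEval {m : ℕ} {A : Fin m → (H →L[ℂ] H)} {T : H →L[ℂ] H}
    (h : ∀ j, Commute T (A j)) (α : Word m) : Commute T (wordEval A α) := by
  induction α with
  | nil => exact Commute.one_right _
  | cons j α ih => rw [wordEval_cons]; exact (h j).mul_right ih

theorem continuous_wordEval {m : ℕ} (α : Word m) :
    Continuous fun A : Fin m → (H →L[ℂ] H) => wordEval A α := by
  induction α with
  | nil => exact continuous_const
  | cons j α ih =>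
    simp only [wordEval_cons]
    exact (continuous_apply j).mul ih

theorem commute_tail {k : ℕ} {n : Fin (k + 1) → ℕ} {X : ∀ i, Fin (n i) → (H →L[ℂ] H)}
    (hX : ∀ s t, s ≠ t → ∀ a c, Commute (X s a) (X t c)) :
    ∀ s t : Fin k, s ≠ t → ∀ a c, Commute (X s.succ a) (X t.succ c) := fun _ _ hst =>
  hX _ _ fun h => hst (Fin.succ_injective _ h)

theorem commute_scale {k : ℕ} {n : Fin k → ℕ} {X : ∀ i, Fin (n i) → (H →L[ℂ] H)}
    (hX : ∀ s t, s ≠ t → ∀ a c, Commute (X s a) (X t c)) (r : Fin k → ℝ) :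
    ∀ s t, s ≠ t → ∀ a c, Commute (scale r X s a) (scale r X t c) := fun s t hst a c =>
  ((hX s t hst a c).smul_left _).smul_right _

variable [CompleteSpace H]

theorem Phi_apply {m : ℕ} (q : PosRegPoly m) (A : Fin m → (H →L[ℂ] H)) (Y : H →L[ℂ] H) :
    Phi q A Y = ∑ α ∈ q.coeff.support,
      (q.coeff α : ℂ) • (wordEval A α * Y * ContinuousLinearMap.adjoint (wordEval A α)) := rfl

theorem isPositive_conj {Y : H →L[ℂ] H} (hY : Y.IsPositive) (T : H →L[ℂ] H) :
    (T * Y * ContinuousLinearMap.adjoint T).IsPositive := by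
  rw [mul_assoc]
  exact hY.conj_adjoint T

/-- Words in $A$ stay on the left of $Y$ and their adjoints on the right, so no commutation between
$A$ and $B^*$ is needed. -/
theorem commute_Phi {m m' : ℕ} (q : PosRegPoly m) (q' : PosRegPoly m')
    {A : Fin m → (H →L[ℂ] H)} {B : Fin m' → (H →L[ℂ] H)} (h : ∀ a c, Commute (A a) (B c)) :
    Commute (Phi q A) (Phi q' B) := by
  have hw : ∀ α β, wordEval A α * wordEval B β = wordEval B β * wordEval A α := fun α β =>
    (commute_wordEval (fun j => (commute_wordEval (fun i => (h i j).symm) α).symm) β).eq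
  have hw' : ∀ α β, ContinuousLinearMap.adjoint (wordEval B β) *
      ContinuousLinearMap.adjoint (wordEval A α) = ContinuousLinearMap.adjoint (wordEval A α) *
        ContinuousLinearMap.adjoint (wordEval B β) := by
    intro α β
    simp only [← ContinuousLinearMap.star_eq_adjoint, ← star_mul, hw]
  refine LinearMap.ext fun Y => ?_
  simp only [Module.End.mul_apply, Phi_apply, Finset.mul_sum, Finset.sum_mul, Finset.smul_sum]
  rw [Finset.sum_comm]
  refine Finset.sum_congr rfl fun β _ => Finset.sum_congr rfl fun α _ => ?_
  rw [mul_smul_comm, smul_mul_assoc, mul_smul_comm, smul_mul_assoc, smul_comm]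
  congr 2
  calc _ = (wordEval A α * wordEval B β) * Y * (ContinuousLinearMap.adjoint (wordEval B β) *
      ContinuousLinearMap.adjoint (wordEval A α)) := by noncomm_ring
    _ = _ := by rw [hw, hw']; noncomm_ring

/-- If `Y ≥ 0` and `Y - Φ(Y) ≥ 0`, then `Y - Φ_t(Y) ≥ (1 - t) Y`, where `Φ_t` belongs to `tA`. -/
theorem isPositive_sub_Phi_smul {m : ℕ} (q : PosRegPoly m) (A : Fin m → (H →L[ℂ] H))
    {t : ℝ} (ht0 : 0 ≤ t) (ht1 : t ≤ 1) {Y : H →L[ℂ] H} (hY : Y.IsPositive)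
    (hY' : ((1 - Phi q A) Y).IsPositive) :
    ((1 - Phi q (fun j => (t : ℂ) • A j)) Y - ((1 - t : ℝ) : ℂ) • Y).IsPositive := by
  -- In this form positivity is visible: words in the support of $q$ are nonempty, so
  -- $t^{2|\alpha|}\le t$.
  have key : (1 - Phi q (fun j => (t : ℂ) • A j)) Y - ((1 - t : ℝ) : ℂ) • Y =
      (t : ℂ) • ((1 - Phi q A) Y) + ∑ α ∈ q.coeff.support,
        ((q.coeff α * (t - t ^ (2 * α.length)) : ℝ) : ℂ) •
          (wordEval A α * Y * ContinuousLinearMap.adjoint (wordEval A α)) := by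
    have h1 : Phi q (fun j => (t : ℂ) • A j) Y = ∑ α ∈ q.coeff.support,
        ((q.coeff α * t ^ (2 * α.length) : ℝ) : ℂ) •
          (wordEval A α * Y * ContinuousLinearMap.adjoint (wordEval A α)) := by
      rw [Phi_apply]
      refine Finset.sum_congr rfl fun α _ => ?_
      rw [wordEval_smul, map_smulₛₗ, smul_mul_assoc, smul_mul_assoc, mul_smul_comm, smul_smul,
        smul_smul]
      congr 1
      simp only [map_pow, Complex.conj_ofReal]
      push_cast
      ring
    have h2 : ∑ α ∈ q.coeff.support, ((q.coeff α * (t - t ^ (2 * α.length)) : ℝ) : ℂ) •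
          (wordEval A α * Y * ContinuousLinearMap.adjoint (wordEval A α)) =
        (t : ℂ) • Phi q A Y - Phi q (fun j => (t : ℂ) • A j) Y := by
      rw [h1, Phi_apply, Finset.smul_sum, ← Finset.sum_sub_distrib]
      refine Finset.sum_congr rfl fun α _ => ?_
      rw [smul_smul, ← sub_smul]
      congr 1
      push_cast
      ring
    rw [h2]
    simp only [LinearMap.sub_apply, Module.End.one_apply]
    push_cast
    module
  rw [key]
  refine (hY'.smul_of_nonneg (by exact_mod_cast ht0)).add
    (ContinuousLinearMap.isPositive_sum _ fun α hα => ?_)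
  refine (isPositive_conj hY _).smul_of_nonneg ?_
  have hl : 0 < α.length := List.length_pos_iff.mpr (q.ne_nil_of_mem_support hα)
  have : t ^ (2 * α.length) ≤ t := by
    simpa using pow_le_pow_of_le_one ht0 ht1 (show 1 ≤ 2 * α.length by omega)
  exact_mod_cast mul_nonneg (q.nonneg α) (sub_nonneg.mpr this)

theorem isPositive_one_sub_Phi_smul {m : ℕ} (q : PosRegPoly m) (A : Fin m → (H →L[ℂ] H))
    {t : ℝ} (ht0 : 0 ≤ t) (ht1 : t ≤ 1) {Y : H →L[ℂ] H} (hY : Y.IsPositive)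
    (hY' : ((1 - Phi q A) Y).IsPositive) :
    ((1 - Phi q (fun j => (t : ℂ) • A j)) Y).IsPositive := by
  have h := (isPositive_sub_Phi_smul q A ht0 ht1 hY hY').add
    (hY.smul_of_nonneg (c := ((1 - t : ℝ) : ℂ)) (by exact_mod_cast sub_nonneg.mpr ht1))
  rwa [sub_add_cancel] at h

theorem defect_zero {n : Fin 0 → ℕ} (q : ∀ i, PosRegPoly (n i))
    (X : ∀ i, Fin (n i) → (H →L[ℂ] H)) (p : Fin 0 → ℕ) : defect q X p = 1 := by
  simp [defect]

theorem defect_succ {k : ℕ} {n : Fin (k + 1) → ℕ} (q : ∀ i, PosRegPoly (n i))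
    (X : ∀ i, Fin (n i) → (H →L[ℂ] H)) (p : Fin (k + 1) → ℕ) :
    defect q X p = (1 - Phi (q 0) (X 0)) ^ p 0 *
      defect (fun i : Fin k => q i.succ) (fun i => X i.succ) (fun i => p i.succ) := by
  rw [defect, List.ofFn_succ, List.prod_cons]; rfl

theorem commute_defect {k : ℕ} {n : Fin k → ℕ} (q : ∀ i, PosRegPoly (n i))
    (X : ∀ i, Fin (n i) → (H →L[ℂ] H)) (p : Fin k → ℕ) {T : Module.End ℂ (H →L[ℂ] H)}
    (h : ∀ i, Commute T (Phi (q i) (X i))) : Commute T (defect q X p) := by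
  refine Commute.list_prod_right _ _ fun x hx => ?_
  obtain ⟨i, rfl⟩ := List.mem_ofFn.mp hx
  exact ((Commute.one_right T).sub_right (h i)).pow_right _

/-- The tail of a commuting tuple, and the commutation of its defects with the head. -/
theorem commute_head_defect {k : ℕ} {n : Fin (k + 1) → ℕ} (q : ∀ i, PosRegPoly (n i))
    {X : ∀ i, Fin (n i) → (H →L[ℂ] H)} (hX : ∀ s t, s ≠ t → ∀ a c, Commute (X s a) (X t c))
    {s : ℂ} {t : Fin k → ℂ} (p : Fin k → ℕ) :
    Commute (1 - Phi (q 0) (fun j => s • X 0 j))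
      (defect (fun i : Fin k => q i.succ) (fun i j => t i • X i.succ j) p) :=
  (Commute.one_left _).sub_left <| commute_defect _ _ _ fun i => commute_Phi _ _ fun a c =>
    ((hX 0 i.succ (Fin.succ_ne_zero i).symm a c).smul_left s).smul_right (t i)

/-- The hypothesis that all the defects of `X` with exponents at most one are positive at `Y`. -/
def HasPositiveDefects {k : ℕ} {n : Fin k → ℕ} (q : ∀ i, PosRegPoly (n i))
    (X : ∀ i, Fin (n i) → (H →L[ℂ] H)) (Y : H →L[ℂ] H) : Prop :=
  ∀ p : Fin k → ℕ, (∀ i, p i ≤ 1) → (defect q X p Y).IsPositive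

theorem HasPositiveDefects.isPositive {k : ℕ} {n : Fin k → ℕ} {q : ∀ i, PosRegPoly (n i)}
    {X : ∀ i, Fin (n i) → (H →L[ℂ] H)} {Y : H →L[ℂ] H} (hY : HasPositiveDefects q X Y) :
    Y.IsPositive := by
  simpa [defect] using hY 0 (by simp)

theorem HasPositiveDefects.isPositive_head {k : ℕ} {n : Fin (k + 1) → ℕ}
    {q : ∀ i, PosRegPoly (n i)} {X : ∀ i, Fin (n i) → (H →L[ℂ] H)} {Y : H →L[ℂ] H}
    (hY : HasPositiveDefects q X Y) : ((1 - Phi (q 0) (X 0)) Y).IsPositive := by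
  have h1 := hY (Pi.single 0 1) (fun i => by
    by_cases h : i = 0
    · subst h; simp
    · simp [h])
  rw [defect_succ] at h1
  simpa [defect, Fin.succ_ne_zero] using h1

/-- This drives the inductions on $k$. The scaled head factor commutes with the tail defects; taking
head exponents 0 and 1 in the hypothesis shows that a tail defect $T$ of $Y$ satisfies $T\ge0$ and
$T-\Phi(T)\ge0$, and this survives scaling of the head. -/
theorem HasPositiveDefects.tail {k : ℕ} {n : Fin (k + 1) → ℕ} {q : ∀ i, PosRegPoly (n i)}
    {X : ∀ i, Fin (n i) → (H →L[ℂ] H)} (hX : ∀ s t, s ≠ t → ∀ a c, Commute (X s a) (X t c))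
    {t : ℝ} (ht0 : 0 ≤ t) (ht1 : t ≤ 1) {Y : H →L[ℂ] H} (hY : HasPositiveDefects q X Y)
    {m : ℕ} (hm : m ≤ 1) :
    HasPositiveDefects (fun i : Fin k => q i.succ) (fun i => X i.succ)
      (((1 - Phi (q 0) (fun j => (t : ℂ) • X 0 j)) ^ m) Y) := by
  intro p' hp'
  have h0 := hY (Fin.cons 0 p') (fun i => by refine Fin.cases ?_ ?_ i <;> simp [hp'])
  have h1 := hY (Fin.cons 1 p') (fun i => by refine Fin.cases ?_ ?_ i <;> simp [hp'])
  rw [defect_succ] at h0 h1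
  simp only [Fin.cons_zero, Fin.cons_succ, pow_zero, one_mul, pow_one,
    Module.End.mul_apply] at h0 h1
  have hc := commute_head_defect q hX (s := (t : ℂ)) (t := fun _ => 1) p'
  simp only [one_smul] at hc
  rcases Nat.le_one_iff_eq_zero_or_eq_one.mp hm with h | h
  · simpa [h] using h0
  · rw [h, pow_one, ← Module.End.mul_apply, ← hc.eq, Module.End.mul_apply]
    exact isPositive_one_sub_Phi_smul _ _ ht0 ht1 h0 h1

/-- The head factor is moved to act first, so that an induction on $k$ can replace $Y$ by its image.
-/
theorem defect_scale_succ {k : ℕ} {n : Fin (k + 1) → ℕ} (q : ∀ i, PosRegPoly (n i))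
    {X : ∀ i, Fin (n i) → (H →L[ℂ] H)} (hX : ∀ s t, s ≠ t → ∀ a c, Commute (X s a) (X t c))
    (t : Fin (k + 1) → ℝ) (p : Fin (k + 1) → ℕ) (Y : H →L[ℂ] H) :
    defect q (scale t X) p Y =
      defect (fun i : Fin k => q i.succ) (scale (fun i => t i.succ) fun i => X i.succ)
        (fun i => p i.succ) (((1 - Phi (q 0) (fun j => (t 0 : ℂ) • X 0 j)) ^ p 0) Y) := by
  have hc := commute_head_defect q hX (s := (t 0 : ℂ)) (t := fun i => (t i.succ : ℂ))
    (fun i => p i.succ)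
  rw [defect_succ, ← Module.End.mul_apply]
  exact congrArg (fun f : Module.End ℂ (H →L[ℂ] H) => f Y) (hc.pow_left _).eq

/-- Scaling down a tuple whose defects are positive at `Y`. -/
theorem isPositive_defect_scale_sub {k : ℕ} {n : Fin k → ℕ} (q : ∀ i, PosRegPoly (n i))
    {X : ∀ i, Fin (n i) → (H →L[ℂ] H)} (hX : ∀ s t, s ≠ t → ∀ a c, Commute (X s a) (X t c))
    {t : Fin k → ℝ} (ht0 : ∀ i, 0 ≤ t i) (ht1 : ∀ i, t i ≤ 1) (Y : H →L[ℂ] H)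
    (hY : HasPositiveDefects q X Y) (p : Fin k → ℕ) (hp : ∀ i, p i ≤ 1) :
    (defect q (scale t X) p Y - ((∏ i, (1 - t i) ^ p i : ℝ) : ℂ) • Y).IsPositive := by
  induction k generalizing Y with
  | zero => simp [defect_zero]
  | succ k ih =>
    set Φ : Module.End ℂ (H →L[ℂ] H) := Phi (q 0) (fun j => (t 0 : ℂ) • X 0 j) with hΦ
    have hstep : (((1 - Φ) ^ p 0) Y - (((1 - t 0) ^ p 0 : ℝ) : ℂ) • Y).IsPositive := by
      rcases Nat.le_one_iff_eq_zero_or_eq_one.mp (hp 0) with h | h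
      · simp [h]
      · rw [h, pow_one, pow_one]
        exact isPositive_sub_Phi_smul _ _ (ht0 0) (ht1 0) hY.isPositive hY.isPositive_head
    have hrec := ih (fun i => q i.succ) (commute_tail hX) (fun i => ht0 i.succ)
      (fun i => ht1 i.succ) (((1 - Φ) ^ p 0) Y) (hY.tail hX (ht0 0) (ht1 0) (hp 0))
      (fun i => p i.succ) (fun i => hp i.succ)
    have hnn : 0 ≤ ∏ i : Fin k, (1 - t i.succ) ^ p i.succ :=
      Finset.prod_nonneg fun i _ => pow_nonneg (sub_nonneg.mpr (ht1 _)) _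
    rw [defect_scale_succ q hX, Fin.prod_univ_succ]
    -- With $Y_1=(1-\Phi)^{p_0}Y$ and $c$ the product over the tail: the tail defect of $Y_1$ is
    -- $\ge cY_1$, and $cY_1\ge c(1-t_0)^{p_0}Y$.
    have := hrec.add (hstep.smul_of_nonneg (c := ((∏ i : Fin k, (1 - t i.succ) ^ p i.succ : ℝ) : ℂ))
      (by exact_mod_cast hnn))
    convert this using 1
    push_cast
    module

theorem scale_mem_polydomain {k : ℕ} {n : Fin k → ℕ} (q : ∀ i, PosRegPoly (n i))
    {X : ∀ i, Fin (n i) → (H →L[ℂ] H)} (hX : X ∈ closedPolydomain q H)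
    {t : Fin k → ℝ} (ht0 : ∀ i, 0 ≤ t i) (ht1 : ∀ i, t i < 1) : scale t X ∈ polydomain q H := by
  have key := isPositive_defect_scale_sub q hX.1 ht0 (fun i => (ht1 i).le) 1 hX.2
  have hpos : ∀ p : Fin k → ℕ, (∀ i, p i ≤ 1) → (defect q (scale t X) p 1).IsPositive := by
    intro p hp
    have hnn : 0 ≤ ∏ i, (1 - t i) ^ p i :=
      Finset.prod_nonneg fun i _ => pow_nonneg (sub_nonneg.mpr (ht1 i).le) _
    have h := (key p hp).add (ContinuousLinearMap.isPositive_one.smul_of_nonneg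
      (c := ((∏ i, (1 - t i) ^ p i : ℝ) : ℂ)) (by exact_mod_cast hnn))
    rwa [sub_add_cancel] at h
  refine ⟨⟨commute_scale hX.1 t, hpos⟩, hpos _ fun _ => le_rfl, ?_⟩
  have hc : 0 < ∏ i, (1 - t i) ^ 1 :=
    Finset.prod_pos fun i _ => pow_pos (sub_pos.mpr (ht1 i)) _
  -- The full defect at $I$ is bounded below by $\prod_i(1-t_i)>0$, hence invertible.
  refine ContinuousLinearMap.isUnit_of_forall_le_norm_inner_map _
    (c := (∏ i, (1 - t i) ^ 1).toNNReal) (Real.toNNReal_pos.mpr hc) fun x => ?_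
  have h := (key _ fun _ => le_rfl).re_inner_nonneg_left x
  rw [sub_apply, inner_sub_left, map_sub, sub_nonneg] at h
  refine le_trans (le_of_eq ?_) (h.trans (RCLike.re_le_norm _))
  rw [Real.coe_toNNReal _ hc.le, smul_apply, one_apply_eq_self, inner_smul_left,
    inner_self_eq_norm_sq_to_K, Complex.conj_ofReal, mul_comm]
  generalize ∏ i, (1 - t i) ^ 1 = c
  have h2 : ((‖x‖ : ℂ)) ^ 2 = ((‖x‖ ^ 2 : ℝ) : ℂ) := by push_cast; rfl
  change _ = Complex.re ((c : ℂ) * (‖x‖ : ℂ) ^ 2)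
  rw [h2, Complex.re_ofReal_mul, Complex.ofReal_re]

/-! ### The closure of the open polydomain. -/

theorem continuous_defect {k : ℕ} {n : Fin k → ℕ} (q : ∀ i, PosRegPoly (n i)) (p : Fin k → ℕ) :
    Continuous fun X : ∀ i, Fin (n i) → (H →L[ℂ] H) => defect q X p 1 := by
  have hPhi : ∀ i (Y : (∀ i, Fin (n i) → (H →L[ℂ] H)) → (H →L[ℂ] H)), Continuous Y →
      Continuous fun X => Phi (q i) (X i) (Y X) := by
    intro i Y hY
    simp only [Phi_apply]
    refine continuous_finsetSum _ fun α _ => ?_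
    have hw := (continuous_wordEval (H := H) α).comp
      (continuous_apply (A := fun i => Fin (n i) → (H →L[ℂ] H)) i)
    exact ((hw.mul hY).mul (ContinuousLinearMap.adjoint.continuous.comp hw)).const_smul
      ((q i).coeff α : ℂ)
  have hpow : ∀ i (m : ℕ) (Y : (∀ i, Fin (n i) → (H →L[ℂ] H)) → (H →L[ℂ] H)), Continuous Y →
      Continuous fun X : ∀ i, Fin (n i) → (H →L[ℂ] H) => ((1 - Phi (q i) (X i)) ^ m) (Y X) := by
    intro i m Y hY
    induction m with
    | zero => simpa using hY
    | succ m ih =>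
      simp only [pow_succ', Module.End.mul_apply, LinearMap.sub_apply, Module.End.one_apply]
      exact ih.sub (hPhi i _ ih)
  have hlist : ∀ l : List (Fin k), Continuous fun X : ∀ i, Fin (n i) → (H →L[ℂ] H) =>
      (l.map fun i => (1 - Phi (q i) (X i)) ^ p i).prod 1 := by
    intro l
    induction l with
    | nil => exact continuous_const
    | cons i l ih =>
      simp only [List.map_cons, List.prod_cons, Module.End.mul_apply]
      exact hpow i _ _ ih
  simp only [defect, List.ofFn_eq_map]
  exact hlist _

theorem isClosed_setOf_isPositive : IsClosed {T : H →L[ℂ] H | T.IsPositive} := by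
  simp only [ContinuousLinearMap.isPositive_def', Set.ofPred_and, Set.ofPred_forall]
  refine IsClosed.inter ?_ (isClosed_iInter fun x => ?_)
  · exact isClosed_eq continuous_star continuous_id
  · refine isClosed_le continuous_const ?_
    simp only [ContinuousLinearMap.reApplyInnerSelf_apply]
    exact RCLike.continuous_re.comp (((ContinuousLinearMap.apply ℂ H x).continuous).inner
      continuous_const)

theorem isClosed_closedPolydomain {k : ℕ} {n : Fin k → ℕ} (q : ∀ i, PosRegPoly (n i)) :
    IsClosed (closedPolydomain q H) := by
  simp only [closedPolydomain, Set.ofPred_and, Set.ofPred_forall]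
  have hcont : ∀ s (a : Fin (n s)), Continuous fun X : ∀ i, Fin (n i) → (H →L[ℂ] H) => X s a :=
    fun s a => (continuous_apply a).comp (continuous_apply s)
  refine IsClosed.inter ?_ ?_
  · refine isClosed_iInter fun s => isClosed_iInter fun t => isClosed_iInter fun _ =>
      isClosed_iInter fun a => isClosed_iInter fun c => ?_
    exact isClosed_eq ((hcont s a).mul (hcont t c)) ((hcont t c).mul (hcont s a))
  · exact isClosed_iInter fun p => isClosed_iInter fun _ =>
      isClosed_setOf_isPositive.preimage (continuous_defect q p)

theorem closure_polydomain {k : ℕ} {n : Fin k → ℕ} (q : ∀ i, PosRegPoly (n i)) :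
    closure (polydomain q H) = closedPolydomain q H := by
  refine subset_antisymm (closure_minimal (fun X hX => hX.1) (isClosed_closedPolydomain q))
    fun X hX => ?_
  have hlim : Filter.Tendsto (fun t : ℝ => scale (fun _ => t) X) (nhdsWithin 1 (Set.Ioo 0 1))
      (nhds X) := by
    have hc : Continuous fun t : ℝ => scale (fun _ : Fin k => t) X :=
      continuous_pi fun i => continuous_pi fun j =>
        (Complex.continuous_ofReal.smul continuous_const)
    have h1 : scale (fun _ : Fin k => (1 : ℝ)) X = X := by
      funext i j
      simp [scale]
    have := hc.tendsto 1
    rw [h1] at this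
    exact this.mono_left nhdsWithin_le_nhds
  have : (nhdsWithin (1 : ℝ) (Set.Ioo 0 1)).NeBot := by
    rw [← mem_closure_iff_nhdsWithin_neBot, closure_Ioo zero_ne_one]
    simp
  refine mem_closure_of_tendsto hlim ?_
  filter_upwards [self_mem_nhdsWithin] with t ht
  exact scale_mem_polydomain q hX (fun _ => ht.1.le) fun _ => ht.2

end Maps

/-! ### Reconstruction of $Y$ from its defect. -/

section Purity

open ContinuousLinearMap (adjoint)

variable {H : Type*} [NormedAddCommGroup H] [InnerProductSpace ℂ H]

/-- The quadratic form of a positive operator, as a function with values in `[0, ∞]`. -/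
def quad (Y : H →L[ℂ] H) (h : H) : ENNReal := ENNReal.ofReal (RCLike.re (inner ℂ (Y h) h))

theorem quad_one (h : H) : quad (1 : H →L[ℂ] H) h = ENNReal.ofReal (‖h‖ ^ 2) := by
  rw [quad, one_apply_eq_self, inner_self_eq_norm_sq]

theorem quad_add {Y Z : H →L[ℂ] H} (hY : Y.IsPositive) (hZ : Z.IsPositive) (h : H) :
    quad (Y + Z) h = quad Y h + quad Z h := by
  rw [quad, quad, quad, ← ENNReal.ofReal_add (hY.re_inner_nonneg_left h) (hZ.re_inner_nonneg_left h),
    add_apply, inner_add_left, map_add]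

theorem quad_smul {c : ℝ} (hc : 0 ≤ c) (Y : H →L[ℂ] H) (h : H) :
    quad ((c : ℂ) • Y) h = ENNReal.ofReal c * quad Y h := by
  rw [quad, quad, ← ENNReal.ofReal_mul hc, smul_apply, inner_smul_left, Complex.conj_ofReal]
  congr 1
  exact Complex.re_ofReal_mul _ _

theorem quad_sum {ι : Type*} (s : Finset ι) {Y : ι → H →L[ℂ] H} (hY : ∀ i ∈ s, (Y i).IsPositive)
    (h : H) : quad (∑ i ∈ s, Y i) h = ∑ i ∈ s, quad (Y i) h := by
  simp only [quad]
  rw [← ENNReal.ofReal_sum_of_nonneg fun i hi => (hY i hi).re_inner_nonneg_left h,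
    sum_apply, sum_inner, map_sum]

theorem multiEval_cons {k : ℕ} {n : Fin (k + 1) → ℕ} (X : ∀ i, Fin (n i) → (H →L[ℂ] H))
    (α : MultiWord n) : multiEval X α =
      wordEval (X 0) (α 0) * multiEval (n := fun i : Fin k => n i.succ) (fun i => X i.succ)
        (fun i => α i.succ) := by
  rw [multiEval, List.ofFn_succ, List.prod_cons]; rfl

variable [CompleteSpace H]

theorem quad_conj (Y T : H →L[ℂ] H) (h : H) : quad (T * Y * adjoint T) h = quad Y (adjoint T h) := by
  rw [quad, quad, ContinuousLinearMap.adjoint_inner_right]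
  rfl

theorem isPositive_Phi {m : ℕ} (q : PosRegPoly m) (A : Fin m → (H →L[ℂ] H)) {Y : H →L[ℂ] H}
    (hY : Y.IsPositive) : (Phi q A Y).IsPositive :=
  ContinuousLinearMap.isPositive_sum _ fun α _ =>
    (isPositive_conj hY _).smul_of_nonneg (by exact_mod_cast q.nonneg α)

theorem quad_Phi {m : ℕ} (q : PosRegPoly m) (A : Fin m → (H →L[ℂ] H)) {Y : H →L[ℂ] H}
    (hY : Y.IsPositive) (h : H) : quad (Phi q A Y) h = ∑ β ∈ q.coeff.support,
      ENNReal.ofReal (q.coeff β) * quad Y (adjoint (wordEval A β) h) := by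
  rw [Phi_apply, quad_sum _ fun α _ =>
    (isPositive_conj hY _).smul_of_nonneg (by exact_mod_cast q.nonneg α)]
  exact Finset.sum_congr rfl fun α _ => by rw [quad_smul (q.nonneg α), quad_conj]

/-- If `Y - Φ(Y) ≥ c Y` with `c > 0`, then `∑ b_α A_α (Y - Φ(Y)) A_α^* = Y`. -/
theorem wsum_quad {m : ℕ} (q : PosRegPoly m) (A : Fin m → (H →L[ℂ] H)) {Y : H →L[ℂ] H}
    (hY : Y.IsPositive) {c : ℝ} (hc : 0 < c)
    (hcY : ((1 - Phi q A) Y - (c : ℂ) • Y).IsPositive) (h : H) :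
    q.wsum (fun α => quad ((1 - Phi q A) Y) (adjoint (wordEval A α) h)) = quad Y h := by
  have hcY' : ((c : ℂ) • Y).IsPositive := hY.smul_of_nonneg (by exact_mod_cast hc.le)
  have hD : ((1 - Phi q A) Y).IsPositive := by
    have := hcY.add hcY'
    rwa [sub_add_cancel] at this
  set u : Word m → ENNReal := fun α => quad Y (adjoint (wordEval A α) h) with hu
  set w : Word m → ENNReal := fun α => quad ((1 - Phi q A) Y) (adjoint (wordEval A α) h) with hw
  -- This is $Y=(Y-\Phi(Y))+\Phi(Y)$ at the vector $A_\alpha^*h$; words grow on the right because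
  -- $A_\beta^*A_\alpha^*=A_{\alpha\beta}^*$.
  have hrec : ∀ α, u α = w α + q.rightTranslate u α := by
    intro α
    have h1 : q.rightTranslate u α = quad (Phi q A Y) (adjoint (wordEval A α) h) := by
      rw [quad_Phi q A hY, PosRegPoly.rightTranslate]
      refine Finset.sum_congr rfl fun β _ => ?_
      simp only [hu, wordEval_append, ← ContinuousLinearMap.star_eq_adjoint, star_mul]
      rfl
    rw [h1, hw, ← quad_add hD (isPositive_Phi q A hY)]
    simp [hu]
  have hle : q.wsum w ≤ u [] := q.wsum_le_of_eq_add (fun _ => ENNReal.ofReal_ne_top) hrec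
  -- From $c\sum b_\alpha u(\alpha)\le\sum b_\alpha w(\alpha)\le u(\emptyset)$. The strict bound
  -- $c>0$ replaces the convergence $\Phi^m(Y)\to0$.
  have hfin : q.wsum u ≠ ⊤ := by
    have h2 : ENNReal.ofReal c * q.wsum u ≤ q.wsum w := by
      rw [← PosRegPoly.wsum_const_mul]
      refine q.wsum_mono fun α => ?_
      have h3 := quad_add hcY hcY' (adjoint (wordEval A α) h)
      rw [sub_add_cancel, quad_smul hc.le] at h3
      simp only [hu, hw]
      rw [h3]
      exact le_add_self
    intro htop
    rw [htop, ENNReal.mul_top (ENNReal.ofReal_pos.mpr hc).ne'] at h2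
    exact absurd (top_le_iff.mp (h2.trans hle)) ENNReal.ofReal_ne_top
  rw [q.wsum_eq_of_eq_add hfin hrec]
  simp only [hu, wordEval_nil, ← ContinuousLinearMap.star_eq_adjoint, star_one, one_apply_eq_self]

/-- `∑ b_α X_α Δ_X(Y) X_α^* = Y` for a strictly scaled tuple. -/
theorem tsum_quad_defect {k : ℕ} {n : Fin k → ℕ} (q : ∀ i, PosRegPoly (n i))
    {X : ∀ i, Fin (n i) → (H →L[ℂ] H)} (hX : ∀ s t, s ≠ t → ∀ a c, Commute (X s a) (X t c))
    {t : Fin k → ℝ} (ht0 : ∀ i, 0 ≤ t i) (ht1 : ∀ i, t i < 1) (Y : H →L[ℂ] H)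
    (hY : HasPositiveDefects q X Y) (h : H) :
    ∑' α : MultiWord n, ENNReal.ofReal (∏ i, (q i).b (α i)) *
      quad (defect q (scale t X) (fun _ => 1) Y) (adjoint (multiEval (scale t X) α) h) =
        quad Y h := by
  induction k generalizing Y h with
  | zero =>
    rw [tsum_eq_single (fun i => i.elim0) fun α hα => (hα (Subsingleton.elim _ _)).elim]
    simp [defect_zero, multiEval, ← ContinuousLinearMap.star_eq_adjoint]
  | succ k ih =>
    set Φ : Module.End ℂ (H →L[ℂ] H) := Phi (q 0) (fun j => (t 0 : ℂ) • X 0 j) with hΦ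
    have hY1 := hY.tail hX (ht0 0) (ht1 0).le le_rfl
    rw [pow_one] at hY1
    have hrec := ih (fun i => q i.succ) (commute_tail hX) (fun i => ht0 i.succ)
      (fun i => ht1 i.succ) ((1 - Φ) Y) hY1
    -- Sum over the first word outside and the remaining words inside: the inner sum is the
    -- induction hypothesis at $(1-\Phi)Y$, the outer one is `wsum_quad`.
    rw [← (Fin.consEquiv fun i => Word (n i)).tsum_eq, ENNReal.tsum_prod',
      ← wsum_quad (q 0) (fun j => (t 0 : ℂ) • X 0 j) hY.isPositive (sub_pos.mpr (ht1 0))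
        (isPositive_sub_Phi_smul _ _ (ht0 0) (ht1 0).le hY.isPositive hY.isPositive_head) h,
      PosRegPoly.wsum]
    refine tsum_congr fun a => ?_
    rw [← hrec, ← ENNReal.tsum_mul_left]
    refine tsum_congr fun α => ?_
    rw [Fin.prod_univ_succ, ENNReal.ofReal_mul ((q 0).b_pos _).le, mul_assoc,
      defect_scale_succ q hX, pow_one, multiEval_cons, ← ContinuousLinearMap.star_eq_adjoint,
      star_mul]
    rfl

end Purity

/-! ### The universal model on the Fock space. -/

section Model

open ContinuousLinearMap (adjoint)

variable {k : ℕ} {n : Fin k → ℕ}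

/-- The orthonormal basis of the Fock space. -/
def fockVec (α : FockIndex.{v} n) : Fock.{v} n := lp.single 2 α 1

theorem inner_fockVec_left (α : FockIndex.{v} n) (x : Fock.{v} n) :
    inner ℂ (fockVec α) x = x α := by
  rw [fockVec, lp.inner_single_left]
  simp

theorem fockVec_apply (α β : FockIndex.{v} n) :
    (fockVec α : Fock.{v} n) β = if β = α then 1 else 0 := by
  rw [fockVec, lp.single_apply]
  by_cases h : β = α
  · subst h; simp
  · simp [h]

theorem norm_fockVec (α : FockIndex.{v} n) : ‖(fockVec α : Fock.{v} n)‖ = 1 := by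
  rw [fockVec, lp.norm_single (by norm_num)]
  simp

theorem fock_ext {E : Type*} [NormedAddCommGroup E] [NormedSpace ℂ E]
    {T S : Fock.{v} n →L[ℂ] E} (h : ∀ α, T (fockVec α) = S (fockVec α)) : T = S := by
  refine lp.ext_continuousLinearMap (by norm_num) fun α => ?_
  ext
  simpa [fockVec] using h α

/-- The multi-word `(α₁, …, β α_i, …, α_k)`. -/
def prependAt (i : Fin k) (β : Word (n i)) (α : FockIndex.{v} n) : FockIndex.{v} n :=
  ULift.up (Function.update α.down i (β ++ α.down i))

theorem universalModel_fockVec (q : ∀ i, PosRegPoly (n i)) (i : Fin k) (j : Fin (n i))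
    (α : FockIndex.{v} n) : universalModel q i j (fockVec α) =
      ((√((q i).b (α.down i)) / √((q i).b (j :: α.down i)) : ℝ) : ℂ) • fockVec (consAt i j α) :=
  universalModel_single q i j α

theorem sqrt_b_ne_zero {m : ℕ} (q : PosRegPoly m) (α : Word m) : √(q.b α) ≠ 0 :=
  (Real.sqrt_pos.mpr (q.b_pos α)).ne'

theorem wordEval_universalModel_fockVec (q : ∀ i, PosRegPoly (n i)) (i : Fin k) (β : Word (n i))
    (α : FockIndex.{v} n) : wordEval (universalModel q i) β (fockVec α) =
      ((√((q i).b (α.down i)) / √((q i).b (β ++ α.down i)) : ℝ) : ℂ) •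
        fockVec (prependAt i β α) := by
  induction β with
  | nil =>
    simp [wordEval_nil, prependAt, sqrt_b_ne_zero]
  | cons j β ih =>
    rw [wordEval_cons, mul_apply_eq_comp, ih, map_smul, universalModel_fockVec, smul_smul]
    have h1 : consAt i j (prependAt i β α) = prependAt i (j :: β) α := by
      simp [consAt, prependAt]
    have h2 : (prependAt i β α).down i = β ++ α.down i := by simp [prependAt]
    rw [h1, h2, ← Complex.ofReal_mul, List.cons_append,
      div_mul_div_cancel₀ (sqrt_b_ne_zero (q i) _)]

theorem adjoint_wordEval_universalModel_fockVec (q : ∀ i, PosRegPoly (n i)) (i : Fin k)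
    (β : Word (n i)) (α : FockIndex.{v} n) :
    adjoint (wordEval (universalModel q i) β) (fockVec α) =
      if β <+: α.down i then
        ((√((q i).b ((α.down i).drop β.length)) / √((q i).b (α.down i)) : ℝ) : ℂ) •
          fockVec (ULift.up (Function.update α.down i ((α.down i).drop β.length)))
      else 0 := by
  ext γ
  rw [← inner_fockVec_left γ, ContinuousLinearMap.adjoint_inner_right,
    wordEval_universalModel_fockVec, inner_smul_left, inner_fockVec_left, Complex.conj_ofReal,
    fockVec_apply]
  by_cases hγ : prependAt i β γ = α
  · subst hγ
    have hu : (ULift.up (Function.update (prependAt i β γ).down i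
        (((prependAt i β γ).down i).drop β.length)) : FockIndex.{v} n) = γ := by
      simp [prependAt]
    have h2 : (prependAt i β γ).down i = β ++ γ.down i := by simp [prependAt]
    have hp : β <+: (prependAt i β γ).down i := h2 ▸ List.prefix_append _ _
    rw [if_pos rfl, if_pos hp, hu, lp.coeFn_smul, Pi.smul_apply, fockVec_apply, if_pos rfl, h2,
      List.drop_left]
    rfl
  · rw [if_neg hγ, mul_zero]
    split_ifs with hp
    · rw [lp.coeFn_smul, Pi.smul_apply, fockVec_apply, if_neg, smul_zero]
      rintro rfl
      apply hγ
      obtain ⟨δ, hδ⟩ := hp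
      apply ULift.ext
      simp [prependAt, ← hδ]
    · rfl

open Classical in
/-- The orthogonal projection onto the span of the `e_α` with `α_i = ∅` for all `i ∈ S`. -/
def emptyProj (S : Finset (Fin k)) : Fock.{v} n →L[ℂ] Fock.{v} n :=
  weightedShift id (fun α => if ∀ i ∈ S, α.down i = [] then 1 else 0) 1 Function.injective_id
    (fun α => by split_ifs <;> simp)

open Classical in
theorem emptyProj_apply (S : Finset (Fin k)) (x : Fock.{v} n) (α : FockIndex.{v} n) :
    emptyProj S x α = if ∀ i ∈ S, α.down i = [] then x α else 0 := by
  have h := Function.injective_id.extend_apply (fun a : FockIndex.{v} n =>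
    (((if ∀ i ∈ S, a.down i = [] then 1 else 0 : ℝ) : ℂ) * x a)) 0 α
  refine h.trans ?_
  split_ifs <;> simp

open Classical in
theorem emptyProj_fockVec (S : Finset (Fin k)) (α : FockIndex.{v} n) :
    emptyProj S (fockVec α) = if ∀ i ∈ S, α.down i = [] then fockVec α else 0 := by
  ext β
  rw [emptyProj_apply]
  by_cases h : β = α
  · subst h
    split_ifs <;> rfl
  · have : (fockVec α : Fock.{v} n) β = 0 := by rw [fockVec_apply, if_neg h]
    rw [this]
    split_ifs
    · exact this.symm
    · rfl
    · exact this.symm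
    · rfl

theorem isPositive_emptyProj (S : Finset (Fin k)) :
    (emptyProj S : Fock.{v} n →L[ℂ] Fock.{v} n).IsPositive := by
  classical
  have hproj : ∀ x y : Fock.{v} n, inner ℂ (emptyProj S x) y =
      inner ℂ (emptyProj S x) (emptyProj S y) := by
    intro x y
    rw [lp.inner_eq_tsum, lp.inner_eq_tsum]
    refine tsum_congr fun α => ?_
    rw [emptyProj_apply, emptyProj_apply]
    split_ifs <;> simp
  refine ⟨fun x y => ?_, fun x => ?_⟩
  · change inner ℂ (emptyProj S x) y = inner ℂ x (emptyProj S y)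
    rw [hproj x y, ← inner_conj_symm x, hproj y x, inner_conj_symm]
  · rw [ContinuousLinearMap.reApplyInnerSelf_apply, hproj]
    exact inner_self_nonneg

theorem emptyProj_empty : (emptyProj ∅ : Fock.{v} n →L[ℂ] Fock.{v} n) = 1 :=
  fock_ext fun α => by simp [emptyProj_fockVec]

/-- Both sides are diagonal in the $e_\alpha$. If the coordinates in $S$ are empty, the left side
has eigenvalue $1-b_{\alpha_i}^{-1}\sum a_\beta b_\gamma$, summed over $\alpha_i=\beta\gamma$; by
`b_eq` it is $1$ for $\alpha_i=\emptyset$ and $0$ otherwise. As $i\notin S$, stripping a prefix of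
$\alpha_i$ leaves the condition on $S$ unchanged. -/
theorem one_sub_Phi_emptyProj (q : ∀ i, PosRegPoly (n i)) {S : Finset (Fin k)} {i : Fin k}
    (hi : i ∉ S) : (1 - Phi (q i) (universalModel.{v} q i)) (emptyProj S) =
      emptyProj (insert i S) := by
  classical
  refine fock_ext fun α => ?_
  set d : ℂ := if ∀ i ∈ S, α.down i = [] then 1 else 0 with hd
  have hterm : ∀ β, (wordEval (universalModel.{v} q i) β * emptyProj S *
      adjoint (wordEval (universalModel.{v} q i) β) : Fock.{v} n →L[ℂ] Fock.{v} n) (fockVec α) =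
      (((if β <+: α.down i then (q i).b ((α.down i).drop β.length) else 0) /
        (q i).b (α.down i) : ℝ) : ℂ) • d • fockVec α := by
    intro β
    rw [mul_apply_eq_comp, mul_apply_eq_comp, adjoint_wordEval_universalModel_fockVec]
    split_ifs with hp
    · obtain ⟨γ, hγ⟩ := hp
      have hS : (∀ s ∈ S, Function.update α.down i ((α.down i).drop β.length) s = []) ↔
          ∀ s ∈ S, α.down s = [] := by
        refine forall₂_congr fun s hs => ?_
        rw [Function.update_of_ne (ne_of_mem_of_not_mem hs hi)]
      rw [map_smul, emptyProj_fockVec, map_smul]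
      simp only [hS]
      by_cases h : ∀ s ∈ S, α.down s = []
      · have hpre : prependAt i β (ULift.up (Function.update α.down i
            ((α.down i).drop β.length)) : FockIndex.{v} n) = α := by
          apply ULift.ext
          simp [prependAt, ← hγ]
        rw [if_pos h, wordEval_universalModel_fockVec, hpre, hd, if_pos h, one_smul, smul_smul,
          ← Complex.ofReal_mul]
        congr 2
        have h3 : β ++ (α.down i).drop β.length = α.down i := by rw [← hγ]; simp
        simp only [Function.update_self, h3]
        rw [div_mul_div_comm, Real.mul_self_sqrt ((q i).b_pos _).le,
          Real.mul_self_sqrt ((q i).b_pos _).le]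
      · rw [if_neg h, hd, if_neg h]
        simp
    · simp
  have hsum := (q i).b_eq (α.down i)
  rw [LinearMap.sub_apply, Module.End.one_apply, sub_apply, Phi_apply, sum_apply]
  simp only [smul_apply, hterm]
  have hPS : emptyProj S (fockVec α) = d • fockVec α := by
    rw [emptyProj_fockVec, hd]
    split_ifs <;> simp
  simp only [smul_smul, ← mul_assoc]
  rw [← Finset.sum_smul, hPS, ← sub_smul, ← Finset.sum_mul]
  have hcoef : ∑ β ∈ (q i).coeff.support, ((q i).coeff β : ℂ) *
      (((if β <+: α.down i then (q i).b ((α.down i).drop β.length) else 0) /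
        (q i).b (α.down i) : ℝ) : ℂ) =
      (((1 - (if α.down i = [] then 1 else 0) / (q i).b (α.down i) : ℝ)) : ℂ) := by
    have hb := ((q i).b_pos (α.down i)).ne'
    rw [one_sub_div hb]
    rw [show (q i).b (α.down i) - (if α.down i = [] then 1 else 0) =
      ∑ β ∈ (q i).coeff.support, (q i).coeff β *
        (if β <+: α.down i then (q i).b ((α.down i).drop β.length) else 0) by linarith]
    rw [Finset.sum_div, Complex.ofReal_sum]
    refine Finset.sum_congr rfl fun β _ => ?_
    rw [mul_div_assoc, Complex.ofReal_mul]
  rw [hcoef, emptyProj_fockVec]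
  simp only [Finset.forall_mem_insert]
  by_cases hα : α.down i = []
  · by_cases h : ∀ s ∈ S, α.down s = []
    · simp [hα, hd, PosRegPoly.b_nil]
    · simp [h, hd]
  · simp [hα]

/-- Each factor with exponent 1 forces one more coordinate to be empty; absence of repetitions makes
that coordinate new. So every defect of $W$ at $I$ is a projection. -/
theorem list_prod_defect_universalModel (q : ∀ i, PosRegPoly (n i)) {p : Fin k → ℕ}
    (hp : ∀ i, p i ≤ 1) (l : List (Fin k)) (hl : l.Nodup) :
    (l.map fun i => (1 - Phi (q i) (universalModel.{v} q i)) ^ p i).prod 1 =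
      emptyProj (l.toFinset.filter fun i => p i = 1) := by
  induction l with
  | nil => simp [emptyProj_empty]
  | cons i l ih =>
    rw [List.nodup_cons] at hl
    rw [List.map_cons, List.prod_cons, Module.End.mul_apply, ih hl.2, List.toFinset_cons,
      Finset.filter_insert]
    rcases Nat.le_one_iff_eq_zero_or_eq_one.mp (hp i) with h | h
    · simp [h]
    · rw [h, pow_one, if_pos rfl, one_sub_Phi_emptyProj]
      simp [hl.1]

theorem commute_universalModel (q : ∀ i, PosRegPoly (n i)) (s t : Fin k) (hst : s ≠ t)
    (a : Fin (n s)) (c : Fin (n t)) :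
    Commute (universalModel.{v} q s a) (universalModel.{v} q t c) := by
  refine fock_ext fun α => ?_
  rw [mul_apply_eq_comp, mul_apply_eq_comp, universalModel_fockVec, universalModel_fockVec,
    map_smul, map_smul, universalModel_fockVec, universalModel_fockVec, smul_smul, smul_smul]
  have h : consAt s a (consAt t c α) = consAt t c (consAt s a α) := by
    apply ULift.ext
    simp only [consAt, Function.update_of_ne hst, Function.update_of_ne hst.symm]
    exact Function.update_comm hst.symm _ _ _
  rw [h]
  congr 1
  simp only [consAt, Function.update_of_ne hst, Function.update_of_ne hst.symm]
  exact mul_comm _ _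

theorem universalModel_mem_closedPolydomain (q : ∀ i, PosRegPoly (n i)) :
    universalModel.{v} q ∈ closedPolydomain q (Fock.{v} n) := by
  refine ⟨commute_universalModel q, fun p hp => ?_⟩
  rw [defect, List.ofFn_eq_map, list_prod_defect_universalModel q hp _ (List.nodup_finRange k)]
  exact isPositive_emptyProj _

theorem multiEval_universalModel_fockVec (q : ∀ i, PosRegPoly (n i)) (α : MultiWord n) :
    multiEval (universalModel.{v} q) α (fockVec (ULift.up fun _ => [])) =
      (((√(∏ i, (q i).b (α i)))⁻¹ : ℝ) : ℂ) • fockVec (ULift.up α) := by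
  -- Coordinates outside the list are still empty, so each new factor contributes exactly
  -- $b_{i,\alpha_i}^{-1/2}$, as $b_\emptyset=1$.
  have key : ∀ l : List (Fin k), l.Nodup →
      (l.map fun i => wordEval (universalModel.{v} q i) (α i)).prod
        (fockVec (ULift.up fun _ => [])) =
      (((l.map fun i => (√((q i).b (α i)))⁻¹).prod : ℝ) : ℂ) •
        fockVec (ULift.up fun i => if i ∈ l then α i else []) := by
    intro l hl
    induction l with
    | nil => simp
    | cons i l ih =>
      rw [List.nodup_cons] at hl
      have hu : prependAt i (α i) (ULift.up fun s => if s ∈ l then α s else [] : FockIndex.{v} n) =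
          ULift.up fun s => if s ∈ i :: l then α s else [] := by
        apply ULift.ext
        funext s
        by_cases hs : s = i
        · subst hs; simp [prependAt, hl.1]
        · simp [prependAt, hs]
      rw [List.map_cons, List.prod_cons, mul_apply_eq_comp, ih hl.2, map_smul,
        wordEval_universalModel_fockVec, hu, smul_smul, ← Complex.ofReal_mul, List.map_cons,
        List.prod_cons]
      simp only [hl.1, if_false, PosRegPoly.b_nil, Real.sqrt_one, List.append_nil, one_div]
      rw [mul_comm]
  rw [multiEval, List.ofFn_eq_map, key _ (List.nodup_finRange k)]
  simp only [List.mem_finRange, if_true]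
  congr 2
  rw [← List.ofFn_eq_map, List.prod_ofFn, Finset.prod_inv_distrib, Real.sqrt_prod]
  exact fun i _ => ((q i).b_pos _).le

end Model

/-! ### Dilations and norms on Hilbert tensor products. -/

section Tensor

open ContinuousLinearMap (adjoint)

variable {K H L : Type*} [NormedAddCommGroup K] [InnerProductSpace ℂ K]
  [NormedAddCommGroup H] [InnerProductSpace ℂ H]
  [NormedAddCommGroup L] [InnerProductSpace ℂ L]

/-- Polarization. Inner products, unlike norms, extend additively from elementary tensors to
$K\otimes H$, which is how `hasSum_inner_mapL` follows. -/
theorem hasSum_inner_of_hasSum_norm_sq {κ : Type*} {V : κ → H →L[ℂ] L}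
    (hV : ∀ h, HasSum (fun c => ‖V c h‖ ^ 2) (‖h‖ ^ 2)) (x y : H) :
    HasSum (fun c => inner ℂ (V c x) (V c y)) (inner ℂ x y) := by
  have hC : ∀ h, HasSum (fun c => ((‖V c h‖ : ℂ)) ^ 2) ((‖h‖ : ℂ) ^ 2) := fun h => by
    exact_mod_cast Complex.hasSum_ofReal.mpr (hV h)
  have h := ((((hC (x + y)).sub (hC (x - y))).add
    (((hC (x - Complex.I • y)).sub (hC (x + Complex.I • y))).mul_right Complex.I)).div_const 4)
  have e : (fun c => inner ℂ (V c x) (V c y)) = fun c =>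
      (((‖V c (x + y)‖ : ℂ)) ^ 2 - (‖V c (x - y)‖ : ℂ) ^ 2 +
        ((‖V c (x - Complex.I • y)‖ : ℂ) ^ 2 - (‖V c (x + Complex.I • y)‖ : ℂ) ^ 2) *
          Complex.I) / 4 := by
    funext c
    rw [inner_eq_sum_norm_sq_div_four (V c x) (V c y)]
    simp
  rw [e, inner_eq_sum_norm_sq_div_four x y]
  exact h

theorem hasSum_inner_mapL {κ : Type*} {V : κ → H →L[ℂ] L}
    (hV : ∀ h, HasSum (fun c => ‖V c h‖ ^ 2) (‖h‖ ^ 2)) (ξ η : K ⊗[ℂ] H) :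
    HasSum (fun c => inner ℂ (TensorProduct.mapL (.id ℂ K) (V c) ξ)
      (TensorProduct.mapL (.id ℂ K) (V c) η)) (inner ℂ ξ η) := by
  induction ξ with
  | zero => simp [hasSum_zero]
  | add ξ₁ ξ₂ h₁ h₂ =>
    simp only [map_add, inner_add_left]
    exact h₁.add h₂
  | tmul a x =>
    induction η with
    | zero => simp [hasSum_zero]
    | add η₁ η₂ h₁ h₂ =>
      simp only [map_add, inner_add_right]
      exact h₁.add h₂
    | tmul b y =>
      simp only [TensorProduct.mapL_tmul, TensorProduct.inner_tmul]
      exact (hasSum_inner_of_hasSum_norm_sq hV x y).mul_left _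

theorem re_inner_self_eq_norm_sq {E : Type*} [NormedAddCommGroup E] [InnerProductSpace ℂ E]
    (z : E) : (inner ℂ z z).re = ‖z‖ ^ 2 := inner_self_eq_norm_sq (𝕜 := ℂ) z

theorem hasSum_norm_sq_mapL {κ : Type*} {V : κ → H →L[ℂ] L}
    (hV : ∀ h, HasSum (fun c => ‖V c h‖ ^ 2) (‖h‖ ^ 2)) (ξ : K ⊗[ℂ] H) :
    HasSum (fun c => ‖TensorProduct.mapL (.id ℂ K) (V c) ξ‖ ^ 2) (‖ξ‖ ^ 2) := by
  have h := Complex.hasSum_re (hasSum_inner_mapL hV ξ ξ)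
  have e : (inner ℂ ξ ξ).re = ‖ξ‖ ^ 2 := re_inner_self_eq_norm_sq ξ
  rw [e] at h
  exact h.congr_fun fun c => (re_inner_self_eq_norm_sq _).symm

theorem opTensor_coe (A : K →L[ℂ] K) (X : H →L[ℂ] H) (ξ : K ⊗[ℂ] H) :
    opTensor A X (ξ : HilbertTensor K H) = (TensorProduct.mapL A X ξ : K ⊗[ℂ] H) :=
  ContinuousLinearMap.completion_apply_coe _ _

theorem sum_opTensor_coe {ι : Type*} (s : Finset ι) (C : ι → K →L[ℂ] K) (S : ι → H →L[ℂ] H)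
    (ξ : K ⊗[ℂ] H) : (∑ α ∈ s, opTensor (C α) (S α)) (ξ : HilbertTensor K H) =
      ((∑ α ∈ s, TensorProduct.mapL (C α) (S α) ξ : K ⊗[ℂ] H) : HilbertTensor K H) := by
  rw [sum_apply]
  simp only [opTensor_coe]
  exact (map_sum (UniformSpace.Completion.toComplL (𝕜 := ℂ) (E := K ⊗[ℂ] H)) _ _).symm

variable [CompleteSpace K] [CompleteSpace H] [CompleteSpace L]

theorem inner_mapL_left (A : K →L[ℂ] K) (X : H →L[ℂ] H) (ξ η : K ⊗[ℂ] H) :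
    inner ℂ (TensorProduct.mapL A X ξ) η =
      inner ℂ ξ (TensorProduct.mapL (adjoint A) (adjoint X) η) := by
  induction ξ with
  | zero => simp
  | add ξ₁ ξ₂ h₁ h₂ => rw [map_add, inner_add_left, inner_add_left, h₁, h₂]
  | tmul a x =>
    induction η with
    | zero => simp
    | add η₁ η₂ h₁ h₂ => rw [map_add, inner_add_right, inner_add_right, h₁, h₂]
    | tmul b y =>
      simp only [TensorProduct.mapL_tmul, TensorProduct.inner_tmul,
        ContinuousLinearMap.adjoint_inner_right]

theorem adjoint_opTensor (A : K →L[ℂ] K) (X : H →L[ℂ] H) :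
    adjoint (opTensor A X) = opTensor (adjoint A) (adjoint X) := by
  symm
  rw [ContinuousLinearMap.eq_adjoint_iff]
  intro x y
  induction x, y using UniformSpace.Completion.induction_on₂ with
  | hp => exact isClosed_eq (by fun_prop) (by fun_prop)
  | ih ξ η =>
    rw [opTensor_coe, opTensor_coe, UniformSpace.Completion.inner_coe,
      UniformSpace.Completion.inner_coe, inner_mapL_left]
    simp

/-- Operators `S_α` which are jointly dilated by `T_α ⊗ I`. -/
theorem norm_sum_opTensor_le {ι κ : Type*} (s : Finset ι) (C : ι → K →L[ℂ] K)
    (S : ι → H →L[ℂ] H) (T : ι → L →L[ℂ] L) {V : κ → H →L[ℂ] L}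
    (hVS : ∀ c, ∀ α ∈ s, V c ∘L adjoint (S α) = adjoint (T α) ∘L V c)
    (hV : ∀ h, HasSum (fun c => ‖V c h‖ ^ 2) (‖h‖ ^ 2)) :
    ‖∑ α ∈ s, opTensor (C α) (S α)‖ ≤ ‖∑ α ∈ s, opTensor (C α) (T α)‖ := by
  set M := ‖∑ α ∈ s, opTensor (C α) (T α)‖ with hM
  have hM0 : 0 ≤ M := norm_nonneg (∑ α ∈ s, opTensor (C α) (T α))
  have hMadj : M = ‖∑ α ∈ s, opTensor (adjoint (C α)) (adjoint (T α))‖ := by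
    rw [hM, ← ContinuousLinearMap.adjoint.norm_map, map_sum]
    simp only [adjoint_opTensor]
  -- The maps $V_c$ intertwine the adjoints, so the estimate is made for the adjoint operators.
  rw [← ContinuousLinearMap.adjoint.norm_map, map_sum]
  simp only [adjoint_opTensor]
  refine ContinuousLinearMap.opNorm_le_bound _ hM0 fun x => ?_
  induction x using UniformSpace.Completion.induction_on with
  | hp => exact isClosed_le (by fun_prop) (by fun_prop)
  | ih ξ =>
    have hint : ∀ c, TensorProduct.mapL (.id ℂ K) (V c)
        (∑ α ∈ s, TensorProduct.mapL (adjoint (C α)) (adjoint (S α)) ξ) =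
        ∑ α ∈ s, TensorProduct.mapL (adjoint (C α)) (adjoint (T α))
          (TensorProduct.mapL (.id ℂ K) (V c) ξ) := by
      intro c
      rw [map_sum]
      refine Finset.sum_congr rfl fun α hα => ?_
      rw [← ContinuousLinearMap.comp_apply, ← ContinuousLinearMap.comp_apply,
        ← TensorProduct.mapL_comp, ← TensorProduct.mapL_comp, hVS c α hα]
      simp
    rw [sum_opTensor_coe, UniformSpace.Completion.norm_coe, UniformSpace.Completion.norm_coe]
    refine le_of_sq_le_sq ?_ (by positivity)
    rw [mul_pow]
    -- The $I\otimes V_c$ are jointly isometric; the bound holds for each $c$ and is summed.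
    refine hasSum_le (fun c => ?_) (hasSum_norm_sq_mapL hV _)
      ((hasSum_norm_sq_mapL hV ξ).mul_left (M ^ 2))
    rw [hint, ← mul_pow]
    refine pow_le_pow_left₀ (norm_nonneg _) ?_ 2
    have h := (∑ α ∈ s, opTensor (adjoint (C α)) (adjoint (T α))).le_opNorm
      ((TensorProduct.mapL (.id ℂ K) (V c) ξ : K ⊗[ℂ] L) : HilbertTensor K L)
    rwa [sum_opTensor_coe, UniformSpace.Completion.norm_coe, UniformSpace.Completion.norm_coe, ← hMadj] at h

end Tensor

/-! ### The Poisson kernel. -/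

section Poisson

open ContinuousLinearMap (adjoint)

variable {k : ℕ} {n : Fin k → ℕ} {H : Type*} [NormedAddCommGroup H] [InnerProductSpace ℂ H]

theorem hasSum_of_ennreal_tsum_eq {ι : Type*} {f : ι → ℝ} (hf : ∀ i, 0 ≤ f i) {c : ℝ} (hc : 0 ≤ c)
    (h : ∑' i, ENNReal.ofReal (f i) = ENNReal.ofReal c) : HasSum f c := by
  have hs : Summable f := by
    have h1 := ENNReal.summable_toReal (h.trans_ne ENNReal.ofReal_ne_top)
    simpa only [ENNReal.toReal_ofReal (hf _)] using h1
  have h2 := ENNReal.ofReal_tsum_of_nonneg hf hs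
  rw [h, ENNReal.ofReal_eq_ofReal_iff (tsum_nonneg hf) hc] at h2
  exact h2 ▸ hs.hasSum

/-- The new letter passes to the front because it commutes with the blocks of smaller index. -/
theorem multiEval_update_cons {X : ∀ i, Fin (n i) → (H →L[ℂ] H)}
    (hX : ∀ s t, s ≠ t → ∀ a c, Commute (X s a) (X t c)) (α : MultiWord n) (i : Fin k)
    (j : Fin (n i)) :
    multiEval X (Function.update α i (j :: α i)) = X i j * multiEval X α := by
  induction k with
  | zero => exact i.elim0
  | succ k ih =>
    revert j
    refine Fin.cases (fun j => ?_) (fun i j => ?_) i <;> rw [multiEval_cons, multiEval_cons]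
    · rw [Function.update_self, wordEval_cons, mul_assoc]
      rfl
    · have h0 : Function.update α i.succ (j :: α i.succ) 0 = α 0 :=
        Function.update_of_ne (Fin.succ_ne_zero i).symm _ _
      have h1 : (fun s : Fin k => Function.update α i.succ (j :: α i.succ) s.succ) =
          Function.update (fun s : Fin k => α s.succ) i (j :: α i.succ) := by
        funext s
        by_cases hs : s = i
        · subst hs; simp
        · rw [Function.update_of_ne hs, Function.update_of_ne fun h => hs (Fin.succ_injective _ h)]
      rw [h0, h1, ih (commute_tail hX) (fun s => α s.succ) i j, ← mul_assoc, ← mul_assoc]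
      congr 1
      exact (commute_wordEval (fun a => hX _ _ (Fin.succ_ne_zero i) j a) (α 0)).eq.symm

/-- The weight of $W_{i,j}$ exactly compensates the change of $\sqrt{b_\alpha}$; this makes the
Poisson kernel intertwining. -/
theorem prod_sqrt_update {q : ∀ i, PosRegPoly (n i)} (α : MultiWord n) (i : Fin k)
    (j : Fin (n i)) :
    √((q i).b (α i)) / √((q i).b (j :: α i)) *
      √(∏ s, (q s).b (Function.update α i (j :: α i) s)) = √(∏ s, (q s).b (α s)) := by
  have h1 : ∏ s, (q s).b (Function.update α i (j :: α i) s) =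
      (q i).b (j :: α i) * ∏ s ∈ Finset.univ.erase i, (q s).b (α s) := by
    rw [← Finset.mul_prod_erase _ _ (Finset.mem_univ i), Function.update_self]
    congr 1
    refine Finset.prod_congr rfl fun s hs => ?_
    rw [Function.update_of_ne (Finset.ne_of_mem_erase hs)]
  have h2 : ∏ s, (q s).b (α s) = (q i).b (α i) * ∏ s ∈ Finset.univ.erase i, (q s).b (α s) :=
    (Finset.mul_prod_erase _ _ (Finset.mem_univ i)).symm
  rw [h1, h2, Real.sqrt_mul ((q i).b_pos _).le, Real.sqrt_mul ((q i).b_pos _).le, ← mul_assoc,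
    div_mul_cancel₀ _ (sqrt_b_ne_zero (q i) _)]

theorem prod_b_pos (q : ∀ i, PosRegPoly (n i)) (α : MultiWord n) : 0 < ∏ i, (q i).b (α i) :=
  Finset.prod_pos fun i _ => (q i).b_pos _

/-- The coordinate `h ↦ (√b_α ⟨X_α g, h⟩)_α` of the Poisson kernel of `X`. -/
theorem exists_poisson (q : ∀ i, PosRegPoly (n i)) (X : ∀ i, Fin (n i) → (H →L[ℂ] H)) (g : H)
    {C : ℝ} (hC : 0 ≤ C)
    (hg : ∀ h : H, ∑' α : MultiWord n, ENNReal.ofReal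
      ((∏ i, (q i).b (α i)) * ‖inner ℂ (multiEval X α g) h‖ ^ 2) ≤ ENNReal.ofReal ((C * ‖h‖) ^ 2)) :
    ∃ V : H →L[ℂ] Fock.{v} n, ∀ h α, V h α =
      (√(∏ i, (q i).b (α.down i)) : ℂ) * inner ℂ (multiEval X α.down g) h := by
  set f : H → FockIndex.{v} n → ℂ := fun h α =>
    (√(∏ i, (q i).b (α.down i)) : ℂ) * inner ℂ (multiEval X α.down g) h with hf
  have hnorm : ∀ h α, ‖f h α‖ ^ (2 : ℝ) =
      (∏ i, (q i).b (α.down i)) * ‖inner ℂ (multiEval X α.down g) h‖ ^ 2 := by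
    intro h α
    rw [Real.rpow_two, hf, norm_mul, mul_pow, Complex.norm_real, Real.norm_eq_abs, sq_abs,
      Real.sq_sqrt (prod_b_pos q _).le]
  have hsum : ∀ h, ∑' α, ENNReal.ofReal (‖f h α‖ ^ (2 : ℝ)) ≤ ENNReal.ofReal ((C * ‖h‖) ^ 2) := by
    intro h
    simp only [hnorm]
    exact ((Equiv.ulift.{v} (α := MultiWord n)).tsum_eq fun α => ENNReal.ofReal
      ((∏ i, (q i).b (α i)) * ‖inner ℂ (multiEval X α g) h‖ ^ 2)).trans_le (hg h)
  have hs : ∀ h, Summable fun α => ‖f h α‖ ^ (2 : ℝ) := by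
    intro h
    have h1 := ENNReal.summable_toReal (ne_top_of_le_ne_top ENNReal.ofReal_ne_top (hsum h))
    simpa only [ENNReal.toReal_ofReal (Real.rpow_nonneg (norm_nonneg _) _)] using h1
  have hle : ∀ h, ∑' α, ‖f h α‖ ^ (2 : ℝ) ≤ (C * ‖h‖) ^ (2 : ℝ) := by
    intro h
    have h1 := hsum h
    rw [← ENNReal.ofReal_tsum_of_nonneg (fun α => Real.rpow_nonneg (norm_nonneg _) _) (hs h),
      ENNReal.ofReal_le_ofReal_iff (sq_nonneg _)] at h1
    rwa [Real.rpow_two]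
  refine ⟨LinearMap.mkContinuous
    { toFun := fun h => ⟨f h, memℓp_gen (by simpa using hs h)⟩
      map_add' := fun x y => by
        ext α
        simp only [hf, inner_add_right, mul_add]
        rfl
      map_smul' := fun c x => by
        ext α
        simp only [hf, inner_smul_right, RingHom.id_apply]
        exact mul_left_comm _ _ _ } C (fun h => ?_), fun h α => rfl⟩
  exact lp.norm_le_of_tsum_le (by norm_num) (by positivity) (by simpa using hle h)

theorem comp_multiEval {L : Type*} [NormedAddCommGroup L] [InnerProductSpace ℂ L]
    {X : ∀ i, Fin (n i) → (H →L[ℂ] H)} {W : ∀ i, Fin (n i) → (L →L[ℂ] L)} {T : L →L[ℂ] H}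
    (h : ∀ i j, X i j ∘L T = T ∘L W i j) (α : MultiWord n) :
    multiEval X α ∘L T = T ∘L multiEval W α := by
  have hw : ∀ i (β : Word (n i)), wordEval (X i) β ∘L T = T ∘L wordEval (W i) β := by
    intro i β
    induction β with
    | nil => rfl
    | cons j β ih =>
      rw [wordEval_cons, wordEval_cons, ContinuousLinearMap.mul_def, ContinuousLinearMap.mul_def,
        ContinuousLinearMap.comp_assoc, ih, ← ContinuousLinearMap.comp_assoc, h,
        ContinuousLinearMap.comp_assoc]
  have hl : ∀ l : List (Fin k), (l.map fun i => wordEval (X i) (α i)).prod ∘L T =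
      T ∘L (l.map fun i => wordEval (W i) (α i)).prod := by
    intro l
    induction l with
    | nil => rfl
    | cons i l ih =>
      rw [List.map_cons, List.prod_cons, List.map_cons, List.prod_cons,
        ContinuousLinearMap.mul_def, ContinuousLinearMap.mul_def,
        ContinuousLinearMap.comp_assoc, ih, ← ContinuousLinearMap.comp_assoc, hw,
        ContinuousLinearMap.comp_assoc]
  rw [multiEval, List.ofFn_eq_map, hl, multiEval, List.ofFn_eq_map]

/-- Parseval's identity in `[0, ∞]`. -/
theorem tsum_norm_sq_inner {κ : Type*} (f : HilbertBasis κ ℂ H) (x : H) :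
    ∑' c, ENNReal.ofReal (‖inner ℂ (f c) x‖ ^ 2) = ENNReal.ofReal (‖x‖ ^ 2) := by
  have h := Complex.hasSum_re (f.hasSum_inner_mul_inner x x)
  rw [re_inner_self_eq_norm_sq] at h
  have h2 : HasSum (fun c => ‖inner ℂ (f c) x‖ ^ 2) (‖x‖ ^ 2) := by
    refine h.congr_fun fun c => ?_
    rw [← inner_conj_symm (f c) x, Complex.mul_conj', RCLike.norm_conj]
    norm_cast
  rw [← h2.tsum_eq, ENNReal.ofReal_tsum_of_nonneg (fun _ => sq_nonneg _) h2.summable]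

variable [CompleteSpace H]

/-- The Poisson kernel of a strictly scaled element of the polydomain. -/
theorem exists_dilation (q : ∀ i, PosRegPoly (n i)) {X : ∀ i, Fin (n i) → (H →L[ℂ] H)}
    (hX : X ∈ closedPolydomain q H) {t : Fin k → ℝ} (ht0 : ∀ i, 0 ≤ t i) (ht1 : ∀ i, t i < 1) :
    ∃ (κ : Set H) (V : κ → H →L[ℂ] Fock.{v} n),
      (∀ c i j, scale t X i j ∘L adjoint (V c) = adjoint (V c) ∘L universalModel q i j) ∧
      ∀ h, HasSum (fun c => ‖V c h‖ ^ 2) (‖h‖ ^ 2) := by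
  set Z := scale t X with hZ
  have hZc : ∀ s t, s ≠ t → ∀ a c, Commute (Z s a) (Z t c) := commute_scale hX.1 t
  have hΔ : (defect q Z (fun _ => 1) 1).IsPositive :=
    (scale_mem_polydomain q hX ht0 ht1).2.1
  obtain ⟨B, hB⟩ := CStarAlgebra.nonneg_iff_eq_star_mul_self.mp
    ((ContinuousLinearMap.nonneg_iff_isPositive _).mpr hΔ)
  have hquad : ∀ h : H, ∑' α : MultiWord n, ENNReal.ofReal ((∏ i, (q i).b (α i)) *
      ‖B (adjoint (multiEval Z α) h)‖ ^ 2) = ENNReal.ofReal (‖h‖ ^ 2) := by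
    intro h
    rw [← quad_one, ← tsum_quad_defect q hX.1 ht0 ht1 1 hX.2 h]
    refine tsum_congr fun α => ?_
    rw [ENNReal.ofReal_mul (prod_b_pos q α).le]
    congr 1
    rw [quad, ← hZ, hB, mul_apply_eq_comp, ContinuousLinearMap.star_eq_adjoint,
      ContinuousLinearMap.adjoint_inner_left, inner_self_eq_norm_sq]
  -- The kernel takes values in $F^2\otimes H$. A Hilbert basis $(f_c)$ of $H$ splits it into
  -- components $V_c$ with values in $F^2$, whose $\alpha$-coordinate is $\sqrt{b_\alpha}\langle
  -- f_c,BZ_\alpha^*h\rangle$.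
  obtain ⟨κ, f, -⟩ := exists_hilbertBasis ℂ H
  have hin : ∀ c (h : H) (α : MultiWord n), inner ℂ (multiEval Z α (adjoint B (f c))) h =
      inner ℂ (f c) (B (adjoint (multiEval Z α) h)) := by
    intro c h α
    rw [← ContinuousLinearMap.adjoint_inner_right, ContinuousLinearMap.adjoint_inner_left]
  have hV : ∀ c : κ, ∃ V : H →L[ℂ] Fock.{v} n, ∀ h α, V h α =
      (√(∏ i, (q i).b (α.down i)) : ℂ) * inner ℂ (multiEval Z α.down (adjoint B (f c))) h := by
    intro c
    refine exists_poisson q Z (adjoint B (f c)) zero_le_one fun h => ?_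
    rw [one_mul, ← hquad h]
    refine ENNReal.tsum_le_tsum fun α => ENNReal.ofReal_le_ofReal ?_
    refine mul_le_mul_of_nonneg_left ?_ (prod_b_pos q α).le
    rw [hin]
    refine pow_le_pow_left₀ (norm_nonneg _) ?_ 2
    refine (norm_inner_le_norm _ _).trans_eq ?_
    rw [f.orthonormal.norm_eq_one, one_mul]
  choose V hV using hV
  refine ⟨κ, V, fun c i j => ?_, fun h => ?_⟩
  · have hT : ∀ α, adjoint (V c) (fockVec α) =
        (√(∏ i, (q i).b (α.down i)) : ℂ) • multiEval Z α.down (adjoint B (f c)) := by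
      intro α
      refine ext_inner_right ℂ fun h => ?_
      rw [ContinuousLinearMap.adjoint_inner_left, inner_fockVec_left, hV, inner_smul_left,
        Complex.conj_ofReal]
    refine fock_ext fun α => ?_
    rw [ContinuousLinearMap.comp_apply, ContinuousLinearMap.comp_apply, universalModel_fockVec,
      map_smul, hT, hT, map_smul, smul_smul, ← Complex.ofReal_mul]
    have h1 : (consAt i j α).down = Function.update α.down i (j :: α.down i) := rfl
    rw [h1, prod_sqrt_update, multiEval_update_cons hZc, mul_apply_eq_comp]
  · refine hasSum_of_ennreal_tsum_eq (fun c => sq_nonneg _) (sq_nonneg _) ?_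
    rw [← hquad h]
    have h1 : ∀ c, ENNReal.ofReal (‖V c h‖ ^ 2) = ∑' α : MultiWord n, ENNReal.ofReal
        ((∏ i, (q i).b (α i)) * ‖inner ℂ (f c) (B (adjoint (multiEval Z α) h))‖ ^ 2) := by
      intro c
      have h2 := lp.hasSum_inner (𝕜 := ℂ) (V c h) (V c h)
      have h3 := Complex.hasSum_re h2
      rw [re_inner_self_eq_norm_sq] at h3
      simp only [re_inner_self_eq_norm_sq] at h3
      rw [← h3.tsum_eq, ENNReal.ofReal_tsum_of_nonneg (fun _ => sq_nonneg _) h3.summable,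
        ← (Equiv.ulift.{v} (α := MultiWord n)).tsum_eq]
      refine tsum_congr fun α => ?_
      rw [hV, norm_mul, mul_pow, Complex.norm_real, Real.norm_eq_abs, sq_abs,
        Real.sq_sqrt (prod_b_pos q _).le, hin]
      rfl
    simp only [h1]
    -- Summing over $c$ first, Parseval turns each term into $b_\alpha\|BZ_\alpha^*h\|^2$.
    rw [ENNReal.tsum_comm]
    refine tsum_congr fun α => ?_
    simp only [ENNReal.ofReal_mul (prod_b_pos q α).le]
    rw [ENNReal.tsum_mul_left, tsum_norm_sq_inner]

end Poisson

/-! ### Passage to the limit in norm inequalities. -/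

section Limits

variable {ι G G' : Type*} [NormedAddCommGroup G] [NormedSpace ℂ G] [NormedAddCommGroup G']
  [NormedSpace ℂ G']

theorem norm_tsum_le_of_sum_le {f : ι → G →L[ℂ] G} {g : ι → G' →L[ℂ] G'} (hf : Summable f)
    (hg : Summable g) (h : ∀ s : Finset ι, ‖∑ i ∈ s, f i‖ ≤ ‖∑ i ∈ s, g i‖) :
    ‖∑' i, f i‖ ≤ ‖∑' i, g i‖ := by
  have h1 := hf.hasSum
  have h2 := hg.hasSum
  rw [HasSum, SummationFilter.unconditional_filter] at h1 h2
  exact le_of_tendsto_of_tendsto' h1.norm h2.norm h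

theorem continuous_norm_sum_smul (s : Finset ι) {c : ι → ℝ → ℂ} (hc : ∀ i, Continuous (c i))
    (f : ι → G →L[ℂ] G) : Continuous fun t => ‖∑ i ∈ s, c i t • f i‖ :=
  (continuous_finsetSum s fun i _ => (hc i).smul continuous_const).norm

end Limits

/-! ### The von Neumann inequality. -/

section Evaluation

variable {k : ℕ} {n : Fin k → ℕ} {K H : Type*} [NormedAddCommGroup K] [InnerProductSpace ℂ K]
  [NormedAddCommGroup H] [InnerProductSpace ℂ H]

theorem scale_scale (r t : Fin k → ℝ) (X : ∀ i, Fin (n i) → (H →L[ℂ] H)) :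
    scale r (scale t X) = scale (fun i => r i * t i) X := by
  funext i j
  simp only [scale, smul_smul, Complex.ofReal_mul]

theorem multiEval_scale (r : Fin k → ℝ) (X : ∀ i, Fin (n i) → (H →L[ℂ] H)) (α : MultiWord n) :
    multiEval (scale r X) α = ((∏ i, r i ^ (α i).length : ℝ) : ℂ) • multiEval X α := by
  induction k with
  | zero => simp [multiEval]
  | succ k ih =>
    have h := ih (fun i => r i.succ) (fun i => X i.succ) (fun i => α i.succ)
    have h0 : wordEval (scale r X 0) (α 0) = (r 0 : ℂ) ^ (α 0).length • wordEval (X 0) (α 0) :=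
      wordEval_smul (r 0 : ℂ) (X 0) (α 0)
    rw [multiEval_cons, multiEval_cons, h0, Fin.prod_univ_succ, Complex.ofReal_mul,
      ← smul_mul_smul_comm, ← h, Complex.ofReal_pow]
    rfl

theorem opTensor_smul (c : ℂ) (A : K →L[ℂ] K) (X : H →L[ℂ] H) :
    opTensor A (c • X) = c • opTensor A X := by
  refine ContinuousLinearMap.ext fun x => ?_
  induction x using UniformSpace.Completion.induction_on with
  | hp => exact isClosed_eq (opTensor A (c • X)).continuous (c • opTensor A X).continuous
  | ih ξ =>
    rw [smul_apply, opTensor_coe, opTensor_coe, TensorProduct.mapL_smul_right, smul_apply,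
      UniformSpace.Completion.coe_smul]

theorem homogPart_scale (A : MultiWord n → (K →L[ℂ] K)) (r : Fin k → ℝ)
    (X : ∀ i, Fin (n i) → (H →L[ℂ] H)) (p : Fin k → ℕ) :
    homogPart A (scale r X) p = ((∏ i, r i ^ p i : ℝ) : ℂ) • homogPart A X p := by
  rw [homogPart, homogPart, Finset.smul_sum]
  refine Finset.sum_congr rfl fun α hα => ?_
  rw [multiEval_scale, opTensor_smul]
  simp only [(mem_Lam n p α).mp hα]

variable [CompleteSpace K] [CompleteSpace H]

/-- The von Neumann inequality for polynomials. -/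
theorem norm_sum_homogPart_le (q : ∀ i, PosRegPoly (n i)) (A : MultiWord n → (K →L[ℂ] K))
    (r : Fin k → ℝ) {X : ∀ i, Fin (n i) → (H →L[ℂ] H)} (hX : X ∈ closedPolydomain q H)
    (s : Finset (Fin k → ℕ)) :
    ‖∑ p ∈ s, homogPart A (scale r X) p‖ ≤
      ‖∑ p ∈ s, homogPart A (scale r (universalModel.{v} q)) p‖ := by
  -- The dilation exists for $tX$ with $t<1$; for fixed finite $s$ the norm is continuous in $t$, so
  -- the bound persists at $t=1$.
  have hstrict : ∀ t ∈ Set.Ioo (0 : ℝ) 1,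
      ‖∑ p ∈ s, homogPart A (scale r (scale (fun _ => t) X)) p‖ ≤
        ‖∑ p ∈ s, homogPart A (scale r (universalModel.{v} q)) p‖ := by
    intro t ht
    obtain ⟨κ, V, hint, hsum⟩ := exists_dilation.{v} q hX (t := fun _ => t)
      (fun _ => ht.1.le) (fun _ => ht.2)
    simp only [homogPart]
    rw [Finset.sum_sigma', Finset.sum_sigma']
    refine norm_sum_opTensor_le _ _ _ _ (fun c x _ => ?_) hsum
    have h1 := comp_multiEval (X := scale r (scale (fun _ => t) X))
      (W := scale r (universalModel.{v} q)) (T := ContinuousLinearMap.adjoint (V c))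
      (fun i j => by
        change ((r i : ℂ) • scale (fun _ => t) X i j) ∘L _ =
          _ ∘L ((r i : ℂ) • universalModel q i j)
        rw [ContinuousLinearMap.smul_comp, ContinuousLinearMap.comp_smul, hint]) x.2
    have h2 := congrArg ContinuousLinearMap.adjoint h1
    rwa [ContinuousLinearMap.adjoint_comp, ContinuousLinearMap.adjoint_comp,
      ContinuousLinearMap.adjoint_adjoint] at h2
  have hcont : Continuous fun t : ℝ => ‖∑ p ∈ s, homogPart A (scale r (scale (fun _ => t) X)) p‖ := by
    have : ∀ (t : ℝ) p, homogPart A (scale r (scale (fun _ => t) X)) p =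
        ((∏ i, (r i * t) ^ p i : ℝ) : ℂ) • homogPart A X p := fun t p => by
      rw [scale_scale, homogPart_scale]
    simp only [this]
    have hc : ∀ p : Fin k → ℕ, Continuous fun t : ℝ => ((∏ i, (r i * t) ^ p i : ℝ) : ℂ) :=
      fun p => Complex.continuous_ofReal.comp (by fun_prop)
    exact continuous_norm_sum_smul s hc _
  have h1 : scale (fun _ : Fin k => (1 : ℝ)) X = X := by
    funext i j
    simp [scale]
  have hlim := (hcont.tendsto 1).mono_left (nhdsWithin_le_nhds (s := Set.Ioo (0 : ℝ) 1))
  rw [h1] at hlim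
  have : (nhdsWithin (1 : ℝ) (Set.Ioo 0 1)).NeBot := by
    rw [← mem_closure_iff_nhdsWithin_neBot, closure_Ioo zero_ne_one]
    simp
  refine le_of_tendsto hlim ?_
  filter_upwards [self_mem_nhdsWithin] with t ht
  exact hstrict t ht

/-- The von Neumann inequality for convergent series. -/
theorem norm_seriesEval_le (q : ∀ i, PosRegPoly (n i)) (A : MultiWord n → (K →L[ℂ] K))
    (r : Fin k → ℝ) {X : ∀ i, Fin (n i) → (H →L[ℂ] H)} (hX : X ∈ closedPolydomain q H)
    (hsX : Summable fun p : Fin k → ℕ => homogPart A (scale r X) p)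
    (hsW : Summable fun p : Fin k → ℕ => homogPart A (scale r (universalModel.{v} q)) p) :
    ‖seriesEval A (scale r X)‖ ≤ ‖seriesEval A (scale r (universalModel.{v} q))‖ :=
  norm_tsum_le_of_sum_le hsX hsW fun s => norm_sum_homogPart_le.{v} q A r hX s

end Evaluation

/-! ### Orthogonality of degrees and the Cauchy inequality. -/

section Cauchy

open ContinuousLinearMap (adjoint)

variable {k : ℕ} {n : Fin k → ℕ} {K : Type u} [NormedAddCommGroup K] [InnerProductSpace ℂ K]

/-- The vector `∑_{α ∈ Λ_p} A_(α) a ⊗ b_α^{-1/2} e_α`. -/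
def homogVec (q : ∀ i, PosRegPoly (n i)) (A : MultiWord n → (K →L[ℂ] K)) (a : K)
    (p : Fin k → ℕ) : K ⊗[ℂ] Fock.{v} n :=
  ∑ α ∈ Lam n p, A α a ⊗ₜ[ℂ] ((((√(∏ i, (q i).b (α i)))⁻¹ : ℝ) : ℂ) • fockVec (ULift.up α))

theorem homogPart_universalModel_vacuum (q : ∀ i, PosRegPoly (n i))
    (A : MultiWord n → (K →L[ℂ] K)) (a : K) (p : Fin k → ℕ) :
    homogPart A (universalModel.{v} q) p
      ((a ⊗ₜ[ℂ] fockVec (ULift.up fun _ => []) : K ⊗[ℂ] Fock.{v} n) :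
        HilbertTensor K (Fock.{v} n)) =
      (homogVec.{u, v} q A a p : HilbertTensor K (Fock.{v} n)) := by
  rw [homogPart, sum_opTensor_coe, homogVec]
  simp only [TensorProduct.mapL_tmul, multiEval_universalModel_fockVec]

theorem inner_fockVec_fockVec (α β : FockIndex.{v} n) :
    inner ℂ (fockVec α : Fock.{v} n) (fockVec β) = if α = β then 1 else 0 := by
  rw [inner_fockVec_left, fockVec_apply]

theorem inner_homogVec_of_ne (q : ∀ i, PosRegPoly (n i)) (A : MultiWord n → (K →L[ℂ] K)) (a : K)
    {p p' : Fin k → ℕ} (h : p ≠ p') :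
    inner ℂ (homogVec.{u, v} q A a p) (homogVec.{u, v} q A a p') = 0 := by
  rw [homogVec, homogVec, sum_inner]
  refine Finset.sum_eq_zero fun α hα => ?_
  rw [inner_sum]
  refine Finset.sum_eq_zero fun β hβ => ?_
  have hne : (ULift.up α : FockIndex.{v} n) ≠ ULift.up β := by
    intro e
    apply h
    have e' : α = β := congrArg ULift.down e
    funext i
    rw [← (mem_Lam n p α).mp hα i, ← (mem_Lam n p' β).mp hβ i, e']
  rw [TensorProduct.inner_tmul, inner_smul_left, inner_smul_right, inner_fockVec_fockVec,
    if_neg hne]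
  simp

/-- Orthonormality of the $e_\alpha$ leaves only diagonal terms, and the squared factor
$b_\alpha^{-1/2}$ gives the weight of the Gram operator. -/
theorem inner_homogVec_self [CompleteSpace K] (q : ∀ i, PosRegPoly (n i))
    (A : MultiWord n → (K →L[ℂ] K)) (a : K) (p : Fin k → ℕ) :
    inner ℂ (homogVec.{u, v} q A a p) (homogVec.{u, v} q A a p) =
      inner ℂ (coeffGram q A p a) a := by
  rw [coeffGram, homogVec, sum_inner, sum_apply, sum_inner]
  refine Finset.sum_congr rfl fun α hα => ?_
  rw [inner_sum, Finset.sum_eq_single α]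
  · rw [TensorProduct.inner_tmul, inner_smul_left, inner_smul_right, inner_fockVec_fockVec,
      if_pos rfl, smul_apply, mul_apply_eq_comp, inner_smul_left,
      ContinuousLinearMap.adjoint_inner_left, Complex.conj_ofReal, Complex.conj_ofReal, mul_one,
      ← Complex.ofReal_mul, ← mul_inv, Real.mul_self_sqrt (prod_b_pos q α).le, mul_comm]
  · intro β _ hβ
    have hne : (ULift.up α : FockIndex.{v} n) ≠ ULift.up β := fun e =>
      hβ (congrArg ULift.down e).symm
    rw [TensorProduct.inner_tmul, inner_smul_left, inner_smul_right, inner_fockVec_fockVec,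
      if_neg hne]
    simp
  · exact fun h => (h hα).elim

theorem norm_homogVec_le (q : ∀ i, PosRegPoly (n i)) (A : MultiWord n → (K →L[ℂ] K))
    (r : Fin k → ℝ)
    (hs : Summable fun p : Fin k → ℕ => homogPart A (scale r (universalModel.{v} q)) p)
    (a : K) (p : Fin k → ℕ) :
    |∏ i, r i ^ p i| * ‖homogVec.{u, v} q A a p‖ ≤
      ‖seriesEval A (scale r (universalModel.{v} q))‖ * ‖a‖ := by
  set F := seriesEval A (scale r (universalModel.{v} q)) with hF
  set ω : HilbertTensor K (Fock.{v} n) :=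
    ((a ⊗ₜ[ℂ] fockVec (ULift.up fun _ => []) : K ⊗[ℂ] Fock.{v} n) :
      HilbertTensor K (Fock.{v} n)) with hω
  have hωn : ‖ω‖ = ‖a‖ := by
    rw [hω, UniformSpace.Completion.norm_coe, TensorProduct.norm_tmul, norm_fockVec, mul_one]
  have h1 : HasSum (fun p' : Fin k → ℕ => homogPart A (scale r (universalModel.{v} q)) p' ω)
      (F ω) := hs.hasSum.mapL (ContinuousLinearMap.apply ℂ _ ω)
  have hterm : ∀ p' : Fin k → ℕ, homogPart A (scale r (universalModel.{v} q)) p' ω =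
      ((∏ i, r i ^ p' i : ℝ) : ℂ) •
        (homogVec.{u, v} q A a p' : HilbertTensor K (Fock.{v} n)) := by
    intro p'
    rw [homogPart_scale, smul_apply, hω, homogPart_universalModel_vacuum]
  simp only [hterm] at h1
  set w : HilbertTensor K (Fock.{v} n) := (homogVec.{u, v} q A a p : HilbertTensor K (Fock.{v} n))
  have h2 := h1.mapL (innerSL ℂ w)
  -- Pairing with the vector of degree $p$ removes every other degree from $F(rW)(a\otimes
  -- e_\emptyset)$.
  have h3 : inner ℂ w (F ω) = ((∏ i, r i ^ p i : ℝ) : ℂ) * inner ℂ w w := by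
    have h4 := h2.unique (hasSum_single p fun p' hp' => ?_)
    · rw [innerSL_apply_apply] at h4
      rw [h4, innerSL_apply_apply, inner_smul_right]
    · rw [innerSL_apply_apply, inner_smul_right, UniformSpace.Completion.inner_coe,
        inner_homogVec_of_ne q A a hp'.symm, mul_zero]
  have h5 : |∏ i, r i ^ p i| * (‖w‖ * ‖w‖) ≤ ‖w‖ * (‖F‖ * ‖a‖) := by
    have h6 := norm_inner_le_norm (𝕜 := ℂ) w (F ω)
    rw [h3, norm_mul, Complex.norm_real, Real.norm_eq_abs, inner_self_eq_norm_sq_to_K, norm_pow,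
      RCLike.norm_ofReal, abs_norm, sq] at h6
    exact h6.trans (mul_le_mul_of_nonneg_left (hωn ▸ F.le_opNorm ω) (norm_nonneg _))
  rw [← UniformSpace.Completion.norm_coe]
  rcases (norm_nonneg w).eq_or_lt with h0 | h0
  · change _ * ‖w‖ ≤ _
    rw [← h0, mul_zero]
    exact mul_nonneg (norm_nonneg F) (norm_nonneg _)
  · refine le_of_mul_le_mul_left ?_ h0
    linarith

theorem isPositive_coeffGram [CompleteSpace K] (q : ∀ i, PosRegPoly (n i))
    (A : MultiWord n → (K →L[ℂ] K)) (p : Fin k → ℕ) : (coeffGram q A p).IsPositive :=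
  ContinuousLinearMap.isPositive_sum _ fun α _ =>
    (ContinuousLinearMap.isPositive_adjoint_comp_self (A α)).smul_of_nonneg
      (by exact_mod_cast inv_nonneg.mpr (prod_b_pos q α).le)

theorem norm_le_of_re_inner_le [CompleteSpace K] {T : K →L[ℂ] K} (hT : T.IsPositive) {c : ℝ}
    (hc : 0 ≤ c) (h : ∀ a, RCLike.re (inner ℂ (T a) a) ≤ c * ‖a‖ ^ 2) : ‖T‖ ≤ c := by
  rw [CStarAlgebra.norm_le_iff_le_algebraMap T hc
    ((ContinuousLinearMap.nonneg_iff_isPositive T).mpr hT), ContinuousLinearMap.le_def,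
    Algebra.algebraMap_eq_smul_one]
  refine ContinuousLinearMap.isPositive_def'.mpr ⟨?_, fun a => ?_⟩
  · exact (IsSelfAdjoint.smul (IsSelfAdjoint.all c) (IsSelfAdjoint.one _)).sub hT.isSelfAdjoint
  · rw [ContinuousLinearMap.reApplyInnerSelf_apply, sub_apply, inner_sub_left, map_sub, sub_nonneg]
    refine (h a).trans_eq ?_
    rw [smul_apply, one_apply_eq_self, inner_smul_left_eq_smul, RCLike.smul_re,
      inner_self_eq_norm_sq]

/-- The Cauchy inequalities. -/
theorem sqrt_norm_coeffGram_le [CompleteSpace K] (q : ∀ i, PosRegPoly (n i))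
    (A : MultiWord n → (K →L[ℂ] K)) {r : Fin k → ℝ} (hr : ∀ i, 0 < r i)
    (hs : Summable fun p : Fin k → ℕ => homogPart A (scale r (universalModel.{v} q)) p)
    (p : Fin k → ℕ) :
    √‖coeffGram q A p‖ ≤
      ‖seriesEval A (scale r (universalModel.{v} q))‖ / ∏ i, r i ^ p i := by
  set M := ‖seriesEval A (scale r (universalModel.{v} q))‖
  have hM0 : 0 ≤ M := norm_nonneg (seriesEval A (scale r (universalModel.{v} q)))
  have hR : 0 < ∏ i, r i ^ p i := Finset.prod_pos fun i _ => pow_pos (hr i) _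
  refine Real.sqrt_le_iff.mpr ⟨div_nonneg hM0 hR.le, ?_⟩
  refine norm_le_of_re_inner_le (isPositive_coeffGram q A p) (sq_nonneg _) fun a => ?_
  have h1 := norm_homogVec_le q A r hs a p
  rw [abs_of_pos hR, mul_comm, ← le_div_iff₀ hR, mul_div_right_comm] at h1
  rw [← inner_homogVec_self.{u, v}, ← mul_pow]
  exact (re_inner_self_eq_norm_sq (homogVec.{u, v} q A a p)).trans_le
    (pow_le_pow_left₀ (norm_nonneg _) h1 2)

end Cauchy

/-! ### Domains of definition and conclusion. -/

theorem scale_closure_subset {k : ℕ} {n : Fin k → ℕ}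
    (q : ∀ i, PosRegPoly (n i)) {ρ r : Fin k → ℝ} (hr : ∀ i, 0 < r i) (hrρ : ∀ i, r i < ρ i)
    (H : Type*) [NormedAddCommGroup H] [InnerProductSpace ℂ H] [CompleteSpace H] :
    scale r '' closure (polydomain q H) ⊆ scale ρ '' polydomain q H := by
  rintro _ ⟨X, hX, rfl⟩
  rw [closure_polydomain] at hX
  have hρ : ∀ i, 0 < ρ i := fun i => (hr i).trans (hrρ i)
  refine ⟨scale (fun i => r i / ρ i) X, scale_mem_polydomain q hX
    (fun i => (div_pos (hr i) (hρ i)).le) (fun i => (div_lt_one (hρ i)).mpr (hrρ i)), ?_⟩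
  rw [scale_scale]
  congr 1
  funext i
  exact mul_div_cancel₀ _ (hρ i).ne'

end RegularPolydomain

end

theorem mainTheorem7 {k : ℕ} {n : Fin k → ℕ} (q : ∀ i, PosRegPoly (n i))
    {K : Type u} [NormedAddCommGroup K] [InnerProductSpace ℂ K] [CompleteSpace K]
    (ρ r : Fin k → ℝ) (hr : ∀ i, 0 < r i) (hrρ : ∀ i, r i < ρ i)
    (A : MultiWord n → (K →L[ℂ] K)) (hA : IsFreeHolomorphic.{u, v} q ρ A) :
    -- the points over which the supremum is taken, and `rW`, lie in the domain `ρ D_q` of `F`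
    (∀ (H : Type v) [NormedAddCommGroup H] [InnerProductSpace ℂ H] [CompleteSpace H],
      scale r '' closure (polydomain q H) ⊆ scale ρ '' polydomain q H) ∧
    scale r (universalModel.{v} q) ∈ scale r '' closure (polydomain q (Fock.{v} n)) ∧
    -- the supremum `M(r)` is finite
    BddAbove (normValues.{u, v} q r A) ∧
    -- the Cauchy inequalities
    (∀ p : Fin k → ℕ, √‖coeffGram q A p‖ ≤ supNorm.{u, v} q r A / ∏ i, r i ^ p i) ∧
    -- the supremum is the norm of `F` at `rW`
    supNorm.{u, v} q r A = ‖seriesEval A (scale r (universalModel.{v} q))‖ := by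
  have hsub : ∀ (H : Type v) [NormedAddCommGroup H] [InnerProductSpace ℂ H] [CompleteSpace H],
      scale r '' closure (polydomain q H) ⊆ scale ρ '' polydomain q H :=
    fun H _ _ _ => scale_closure_subset q hr hrρ H
  have hW : scale r (universalModel.{v} q) ∈ scale r '' closure (polydomain q (Fock.{v} n)) :=
    ⟨universalModel.{v} q, by
      rw [closure_polydomain]; exact universalModel_mem_closedPolydomain q, rfl⟩
  have hsW := hA _ _ (hsub _ hW)
  -- The Fock space lies in the universe of the spaces considered, so $rW$ is a competitor and the
  -- supremum is a maximum, hence finite.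
  have hgreat : IsGreatest (normValues.{u, v} q r A)
      ‖seriesEval A (scale r (universalModel.{v} q))‖ := by
    refine ⟨⟨Fock.{v} n, inferInstance, inferInstance, inferInstance, _, hW, rfl⟩, ?_⟩
    rintro _ ⟨H, _, _, _, _, ⟨X, hX, rfl⟩, rfl⟩
    have hs := hA _ _ (hsub _ ⟨X, hX, rfl⟩)
    rw [closure_polydomain] at hX
    exact norm_seriesEval_le.{v} q A r hX hs hsW
  have hsup : supNorm.{u, v} q r A = ‖seriesEval A (scale r (universalModel.{v} q))‖ :=
    hgreat.csSup_eq
  refine ⟨hsub, hW, hgreat.bddAbove, fun p => ?_, hsup⟩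
  rw [hsup]
  exact sqrt_norm_coeffGram_le q A hr hsW p
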